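/- **Theorem.** Let $n\ge 1$ and let $\Gamma$ be a group of type $F_n$ and of cohomological dimension $n$ (the projective dimension of the trivial $\mathbb{Z}\Gamma$-module $\mathbb{Z}$). Let $X$ be a simplicial complex witnessing that $\Gamma$ is of type $F_n$: $X$ is contractible, $\Gamma$ acts on it freely by simplicial automorphisms (no simplex is mapped to itself by a non-trivial element), and there are only finitely many $\Gamma$-orbits of simplices of dimension $\le n$. Let $F$ be a fundamental domain, i.e. a set of simplices such that for every simplex $\sigma$ of $X$ there is a unique $\gamma_\sigma\in\Gamma$ with $\gamma_\sigma\sigma\in F$. Let $S$ be a finite generating set of $\Gamma$, let $\mathcal H$ be a complex Hilbert space, and equip $\operatorname{Hom}(\Gamma,U(\mathcal H))$ with the metric $d_S(\pi,\rho)=\sup_{s\in S}\|\pi(s)-\rho(s)\|$, where $\|\cdot\|$ is the operator norm. Let $1\le p<\infty$. For $k\ge 0$ let $C^k_{(p)}(X,\Gamma,\mathcal H)$ be the space of alternating $\mathcal H$-valued functions $f$ on the ordered $k$-simplices of $X$ that satisfy $f(\sigma)=f(\gamma_\sigma\sigma)$ and $$\|f\|_p=\Big(\sum_{\sigma\in F^{(k)}}\|f(\sigma)\|^p\Big)^{1/p}<\infty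 ,$$ where $F^{(k)}$ is the set of $k$-simplices in $F$. For $\pi\in\operatorname{Hom}(\Gamma,U(\mathcal H))$ let $$d^k_\pi f(\sigma)=\sum_{i=0}^{k+1}(-1)^i\,\pi(\gamma_\sigma)\,\pi(\gamma_{\sigma_i})^{-1}f(\sigma_i),\qquad \sigma_i=(v_0,\dots,\hat v_i,\dots,v_{k+1})\ \text{ for }\ \sigma=(v_0,\dots,v_{k+1}),$$ and let $$\kappa_k(\Gamma,X,p,\pi)=\inf\Big\{\frac{\|d^k_\pi f\|_p}{\inf_{v\in\ker d^k_\pi}\|f+v\|_p}\ :\ f\in C^k_{(p)}(X,\Gamma,\mathcal H),\ f\notin\ker d^k_\pi\Big\}\in[0,\infty]$$ be the $k$-th Kazhdan constant (with $\inf\emptyset=+\infty$). Suppose that $$\inf\big\{\kappa_{n-1}(\Gamma,X,p,\pi)\ :\ \pi\in\operatorname{Hom}(\Gamma,U(\mathcal H)),\ H^n(\Gamma,\pi)=0\big\}>0 .$$ Then the vanishing of $H^n(\Gamma,\pi)$ is stable on connected components of $\operatorname{Hom}(\Gamma,U(\mathcal H))$: for every connected component $\mathcal C\subseteq\operatorname{Hom}(\Gamma,U(\mathcal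 H))$ the following conditions are equivalent: 1. $H^n(\Gamma,\pi)=0$ for some $\pi\in\mathcal C$; 2. $H^n(\Gamma,\pi)=0$ for all $\pi\in\mathcal C$. -/

import Mathlib

open scoped Pointwise ENNReal Nat

noncomputable section

namespace HigherKazhdan

/-! ### Simplicial complexes, realizations and actions -/

section Complexes

variable {V : Type} (X : AbstractSimplicialComplex V)

/-- The geometric realization `|X|`: barycentric coordinates on the vertex set that are nonnegative,
supported on a simplex of `X`, and of total mass one. -/
def Realization : Type :=
  {x : V → ℝ // ∃ s ∈ X.faces, (∀ v, 0 ≤ x v) ∧ (∀ v, v ∉ s → x v = 0) ∧ ∑ v ∈ s, x v = 1}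

/-- The closed simplex of `|X|` spanned by the finite vertex set `s`. -/
def ClosedCell (s : Finset V) : Type :=
  {x : Realization X // ∀ v, v ∉ s → x.1 v = 0}

/-- A closed simplex carries its Euclidean topology, that of its barycentric coordinates. -/
instance (s : Finset V) : TopologicalSpace (ClosedCell X s) :=
  TopologicalSpace.induced (fun x v => x.1.1 v) (inferInstance : TopologicalSpace (V → ℝ))

/-- The weak topology: a subset of `|X|` is open iff its intersection with each closed simplex is
open in that simplex. -/
instance : TopologicalSpace (Realization X) :=
  ⨆ s : X.faces, TopologicalSpace.coinduced
    (fun x : ClosedCell X s.1 => x.1) inferInstance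

/-- Ordered `k`-simplices `(v₀, …, v_k)` of `X`: the `v_i` are distinct and span a simplex. -/
def OrdSimplex [DecidableEq V] (k : ℕ) : Type :=
  {σ : Fin (k + 1) → V // Function.Injective σ ∧ Finset.univ.image σ ∈ X.faces}

variable {X} [DecidableEq V] {k : ℕ}

/-- The underlying (unordered) simplex. -/
def OrdSimplex.verts (σ : OrdSimplex X k) : Finset V := Finset.univ.image σ.1

/-- Reordering of the vertices. -/
def OrdSimplex.reorder (σ : OrdSimplex X k) (τ : Equiv.Perm (Fin (k + 1))) : OrdSimplex X k :=
  ⟨fun i => σ.1 (τ i), σ.2.1.comp τ.injective, by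
    have h : (Finset.univ.image fun i => σ.1 (τ i)) = Finset.univ.image σ.1 := by
      ext v
      simp only [Finset.mem_image, Finset.mem_univ, true_and]
      exact ⟨fun ⟨i, hi⟩ => ⟨τ i, hi⟩, fun ⟨i, hi⟩ => ⟨τ.symm i, by simpa using hi⟩⟩
    rw [h]
    exact σ.2.2⟩

/-- The face `σ_i = (v₀, …, v̂_i, …, v_{k+1})`. -/
def OrdSimplex.face (σ : OrdSimplex X (k + 1)) (i : Fin (k + 2)) : OrdSimplex X k :=
  ⟨fun j => σ.1 (i.succAbove j), σ.2.1.comp Fin.succAbove_right_injective,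
    (X.isRelLowerSet_faces σ.2.2).2
      (by
        intro v hv
        simp only [Finset.mem_image, Finset.mem_univ, true_and] at hv ⊢
        obtain ⟨j, hj⟩ := hv
        exact ⟨_, hj⟩)
      (by simp)⟩

variable (Γ : Type) [Group Γ] [MulAction Γ V] (X)

/-- The action of `Γ` on the vertices of `X` is by simplicial automorphisms. -/
class IsSimplicialAction : Prop where
  smul_mem : ∀ (g : Γ) (s : Finset V), s ∈ X.faces → g • s ∈ X.faces

/-- `X` witnesses that `Γ` is of type `F_n`: `X` is a contractible simplicial complex (the universal
cover of an Eilenberg–MacLane space of `Γ`) on which `Γ` acts freely (no simplex is mapped to itself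
by a nontrivial element), with finitely many orbits of simplices of dimension at most `n`. -/
structure IsTypeFModel [IsSimplicialAction X Γ] (n : ℕ) : Prop where
  contractible : ContractibleSpace (Realization X)
  free : ∀ (g : Γ) (s : Finset V), s ∈ X.faces → g • s = s → g = 1
  finite_skeleton : ∃ T : Set (Finset V), T.Finite ∧
    ∀ s ∈ X.faces, s.card ≤ n + 1 → ∃ g : Γ, g • s ∈ T

/-- A fundamental domain: a set `F` of simplices such that for each simplex `σ` there is a unique
`γ ∈ Γ` with `γ • σ ∈ F`. -/
structure FundamentalDomain where
  carrier : Set (Finset V)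
  subset_faces : carrier ⊆ X.faces
  existsUnique : ∀ s ∈ X.faces, ∃! g : Γ, g • s ∈ carrier

variable {Γ X}

/-- The translate of an ordered simplex. -/
instance [IsSimplicialAction X Γ] : SMul Γ (OrdSimplex X k) where
  smul g σ := ⟨fun i => g • σ.1 i, (MulAction.injective g).comp σ.2.1, by
    have h : (Finset.univ.image fun i => g • σ.1 i) = g • Finset.univ.image σ.1 := by
      ext v
      simp [Finset.mem_smul_finset]
    rw [h]
    exact IsSimplicialAction.smul_mem g _ σ.2.2⟩

/-- The element `γ_σ`, the unique one with `γ_σ • σ ∈ F`. -/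
def FundamentalDomain.toDomain (F : FundamentalDomain X Γ) (σ : OrdSimplex X k) : Γ :=
  (F.existsUnique σ.verts σ.2.2).choose

end Complexes

/-! ### Cochains twisted by a unitary representation, Kazhdan constants -/

section Cochains

variable {V : Type} [DecidableEq V] {X : AbstractSimplicialComplex V}
  {Γ : Type} [Group Γ] [MulAction Γ V] [IsSimplicialAction X Γ] (F : FundamentalDomain X Γ)
  {H : Type} [NormedAddCommGroup H] [InnerProductSpace ℂ H] [CompleteSpace H]

/-- The norm `‖f‖_p = (∑_{σ ∈ F^{(k)}} ‖f σ‖^p)^{1/p}`, with values in `[0, ∞]`. The sum runs over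
ordered simplices, so each simplex of `F` is counted `(k+1)!` times; for alternating `f` the number
`‖f σ‖` does not depend on the ordering, and the factor `1/(k+1)!` compensates. -/
def cochainNorm (p : ℝ) {k : ℕ} (f : OrdSimplex X k → H) : ℝ≥0∞ :=
  (((k + 1)! : ℝ≥0∞)⁻¹ * ∑' σ : {σ : OrdSimplex X k // σ.verts ∈ F.carrier}, ‖f σ.1‖ₑ ^ p) ^ (1 / p)

/-- The space `C^k_{(p)}(X, Γ, H)` of `p`-integrable untwisted cochains. -/
structure IsCochain (p : ℝ) {k : ℕ} (f : OrdSimplex X k → H) : Prop where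
  alternating : ∀ (σ : OrdSimplex X k) (τ : Equiv.Perm (Fin (k + 1))),
    f (σ.reorder τ) = (Equiv.Perm.sign τ : ℤ) • f σ
  invariant : ∀ σ : OrdSimplex X k, f (F.toDomain σ • σ) = f σ
  integrable : cochainNorm F p f < ∞

/-- The codifferential twisted by `π`,
`(d_π f)(σ) = ∑ i, (-1)^i π(γ_σ) π(γ_{σ_i})⁻¹ f(σ_i)`. -/
def codiff (π : Γ →* unitary (H →L[ℂ] H)) {k : ℕ} (f : OrdSimplex X k → H) :
    OrdSimplex X (k + 1) → H := fun σ =>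
  ∑ i : Fin (k + 2), (-1 : ℤ) ^ (i : ℕ) •
    (π (F.toDomain σ * (F.toDomain (σ.face i))⁻¹) : H →L[ℂ] H) (f (σ.face i))

/-- The `k`-th Kazhdan constant `κ_k(Γ, X, p, π)`: the infimum, in `[0, ∞]`, of
`‖d_π f‖ / inf_{v ∈ ker d_π} ‖f + v‖` over the cochains `f ∉ ker d_π` of degree `k`. -/
def kazhdanConstant (p : ℝ) (k : ℕ) (π : Γ →* unitary (H →L[ℂ] H)) : ℝ≥0∞ :=
  ⨅ (f : OrdSimplex X k → H) (_ : IsCochain F p f) (_ : codiff F π f ≠ 0),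
    cochainNorm F p (codiff F π f) /
      ⨅ (v : OrdSimplex X k → H) (_ : IsCochain F p v) (_ : codiff F π v = 0),
        cochainNorm F p (f + v)

end Cochains

/-! ### Group cohomology and the space of unitary representations -/

section Representations

variable {Γ : Type} [Group Γ] {H : Type} [NormedAddCommGroup H] [InnerProductSpace ℂ H]
  [CompleteSpace H]

/-- The `ℤΓ`-module structure on `H` given by a unitary representation. -/
def toRepresentation (π : Γ →* unitary (H →L[ℂ] H)) : Representation ℤ Γ H where
  toFun g := ((π g : H →L[ℂ] H) : H →ₗ[ℂ] H).restrictScalars ℤ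
  map_one' := by ext v; simp
  map_mul' g h := by ext v; simp

/-- `H^n(Γ, π) = 0`, for the group cohomology of `Γ` with coefficients in the module `(H, π)`. -/
def CohomologyVanishes (n : ℕ) (π : Γ →* unitary (H →L[ℂ] H)) : Prop :=
  Subsingleton (groupCohomology (Rep.of (toRepresentation π)) n)

/-- The cohomological dimension of `Γ`: the projective dimension of the trivial `ℤΓ`-module `ℤ`. -/
def cohomologicalDimension (Γ : Type) [Group Γ] : WithBot ℕ∞ :=
  CategoryTheory.projectiveDimension (Rep.trivial ℤ Γ ℤ)

variable (H) in
/-- `Hom(Γ, U(H))`, to be given the metric `d_S`. -/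
def HomU (_S : Finset Γ) : Type := Γ →* unitary (H →L[ℂ] H)

instance (S : Finset Γ) : PseudoMetricSpace (HomU H S) :=
  PseudoMetricSpace.induced
    (fun (π : Γ →* unitary (H →L[ℂ] H)) (s : S) => (π s : H →L[ℂ] H)) inferInstance

/-- The metric on `Hom(Γ, U(H))` is `d_S(π, ρ) = sup_{s ∈ S} ‖π s - ρ s‖`. -/
theorem HomU.dist_eq (S : Finset Γ) (π ρ : Γ →* unitary (H →L[ℂ] H)) :
    dist (α := HomU H S) π ρ = ⨆ s : S, ‖(π s : H →L[ℂ] H) - ρ s‖ := by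
  change dist (fun s : S => (π s : H →L[ℂ] H)) (fun s : S => (ρ s : H →L[ℂ] H)) = _
  apply le_antisymm
  · refine (dist_pi_le_iff (Real.iSup_nonneg fun _ => norm_nonneg _)).2 fun s => ?_
    rw [dist_eq_norm]
    exact le_ciSup (f := fun s : S => ‖(π s : H →L[ℂ] H) - ρ s‖)
      (Set.finite_range _).bddAbove s
  · refine Real.iSup_le (fun s => ?_) dist_nonneg
    rw [← dist_eq_norm]
    exact dist_le_pi_dist (fun s : S => (π s : H →L[ℂ] H)) (fun s : S => (ρ s : H →L[ℂ] H)) s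

end Representations

end HigherKazhdan

end

open HigherKazhdan

/-! Write n = m + 1. It suffices to find one δ > 0 such that vanishing of H^n passes from any π to
every ρ at distance less than δ (`exists_forall_cohomologyVanishes_of_dist_lt`). Since δ serves all
π at once, non-vanishing is open too, so the vanishing locus is clopen and contains every component
it meets.

The simplicial chain complex of X is a projective resolution of ℤ (`ordResolution`), so equivariant
cochains compute H^n. There are finitely many orbits in dimensions m and n, but possibly infinitely
many in dimension n + 1, so the cocycle condition in degree n is encoded differently. As cd Γ ≤ n,
the boundaries in degree m form a projective module; splitting ∂ onto it gives an equivariant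
endomorphism e of the n-chains with ∂e = ∂ and e∂ = 0 (`exists_retraction_ordRep`). Its dual is an
idempotent whose image is the n-cocycles, and H^n vanishes iff this image lies in the image of the
coboundary operator (`subsingleton_groupCohomology_iff_op`).

In coordinates on F both operators act between fixed Banach spaces, finite powers of the Hilbert
space, and are Lipschitz in π (`exists_norm_opCLM_le`). The bound on the Kazhdan constants gives
coboundary preimages with a norm bound uniform in π (`exists_op_eq_of_lt_kazhdanConstant`).
Surjectivity with a bounded right inverse survives small perturbations, and adjoining 1 - e to the
coboundary operator turns "onto the range of e" into plain surjectivity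
(`exists_apply_eq_of_perturbation`).

Exactness of the chains follows from contractibility of |X|: a cycle is subdivided into small
sequences of points, moved along the contraction and approximated by vertices
(`exists_bd_of_contractible`). This is done with arbitrary vertex sequences, where cones and prisms
are simple; sorting vertices makes the oriented chains a direct summand (`proj_sort`). -/

noncomputable section

namespace HigherKazhdan

/-! ### Augmented chain complexes of lists -/

namespace ListChain

variable {A B : Type*}

/-- Formal integral combinations of finite sequences; the empty sequence gives the augmentation. -/
abbrev _root_.HigherKazhdan.ListChain (A : Type*) : Type _ := List A →₀ ℤ

/-- The cone with apex `a`. -/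
def cone (a : A) : ListChain A →ₗ[ℤ] ListChain A := Finsupp.lmapDomain ℤ ℤ (List.cons a)

@[simp] lemma cone_single (a : A) (l : List A) (c : ℤ) :
    cone a (Finsupp.single l c) = Finsupp.single (a :: l) c := by
  simp [cone]

/-- The boundary of a sequence. -/
def bdList : List A → ListChain A
  | [] => 0
  | a :: l => Finsupp.single l 1 - cone a (bdList l)

/-- The boundary operator. -/
def bd : ListChain A →ₗ[ℤ] ListChain A := Finsupp.linearCombination ℤ bdList

lemma bd_single (l : List A) : bd (Finsupp.single l 1) = bdList l := by
  simp [bd]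

@[simp] lemma bd_nil : bd (Finsupp.single ([] : List A) 1) = 0 := by
  simp [bd_single, bdList]

lemma hom_ext {M : Type*} [AddCommGroup M] {f g : ListChain A →ₗ[ℤ] M}
    (h : ∀ l, f (Finsupp.single l 1) = g (Finsupp.single l 1)) : f = g :=
  Finsupp.lhom_ext' fun l => LinearMap.ext_ring (h l)

/-- Coning is a contracting homotopy in every degree, the lowest included, because the empty
sequence is a basis element. -/
lemma bd_cone (a : A) (x : ListChain A) : bd (cone a x) = x - cone a (bd x) := by
  have : bd ∘ₗ cone a = LinearMap.id - cone a ∘ₗ bd :=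
    hom_ext fun l => by simp [bd_single, bdList]
  exact LinearMap.congr_fun this x

lemma bd_bd (x : ListChain A) : bd (bd x) = 0 := by
  have : (bd ∘ₗ bd : ListChain A →ₗ[ℤ] ListChain A) = 0 := by
    refine hom_ext fun l => ?_
    induction l with
    | nil => simp
    | cons a l ih =>
      simp only [LinearMap.comp_apply, LinearMap.zero_apply] at ih ⊢
      rw [← cone_single, bd_cone, map_sub, bd_cone, ih]
      simp
  exact LinearMap.congr_fun this x

/-- The map on chains induced by a map of vertices. -/
def map (f : A → B) : ListChain A →ₗ[ℤ] ListChain B := Finsupp.lmapDomain ℤ ℤ (List.map f)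

@[simp] lemma map_single (f : A → B) (l : List A) (c : ℤ) :
    map f (Finsupp.single l c) = Finsupp.single (l.map f) c := by
  simp [map]

lemma map_cone (f : A → B) (a : A) (x : ListChain A) : map f (cone a x) = cone (f a) (map f x) := by
  have : map f ∘ₗ cone a = cone (f a) ∘ₗ map f := hom_ext fun l => by simp
  exact LinearMap.congr_fun this x

lemma bd_map (f : A → B) (x : ListChain A) : bd (map f x) = map f (bd x) := by
  have : bd ∘ₗ map f = map f ∘ₗ bd := by
    refine hom_ext fun l => ?_
    induction l with
    | nil => simp
    | cons a l ih =>
      simp only [LinearMap.comp_apply] at ih ⊢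
      rw [← cone_single, bd_cone, map_cone, bd_cone, ih, map_sub, map_cone]
  exact LinearMap.congr_fun this x

/-- Chains all of whose terms belong to `S`. -/
abbrev supp (S : Set (List A)) : Submodule ℤ (ListChain A) := Finsupp.supported ℤ ℤ S

lemma single_mem_supp {S : Set (List A)} {l : List A} (h : l ∈ S) (c : ℤ) :
    Finsupp.single l c ∈ supp S :=
  Finsupp.single_mem_supported ℤ c h

lemma hom_mem {M : Type*} [AddCommGroup M] {S : Set (List A)} (f : ListChain A →ₗ[ℤ] M)
    (N : Submodule ℤ M) (h : ∀ l ∈ S, f (Finsupp.single l 1) ∈ N) {z : ListChain A}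
    (hz : z ∈ supp S) : f z ∈ N := by
  have : supp S ≤ N.comap f := by
    rw [supp, Finsupp.supported_eq_span_single, Submodule.span_le]
    rintro _ ⟨l, hl, rfl⟩
    exact h l hl
  exact this hz

lemma hom_congr {M : Type*} [AddCommGroup M] {S : Set (List A)} {f g : ListChain A →ₗ[ℤ] M}
    (h : ∀ l ∈ S, f (Finsupp.single l 1) = g (Finsupp.single l 1)) {z : ListChain A}
    (hz : z ∈ supp S) : f z = g z := by
  have := hom_mem (f - g) ⊥ (fun l hl => by simp [h l hl]) hz
  simpa [sub_eq_zero] using this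

lemma cone_mem {S T : Set (List A)} {a : A} (h : ∀ l ∈ S, a :: l ∈ T) {z : ListChain A}
    (hz : z ∈ supp S) : cone a z ∈ supp T :=
  hom_mem _ _ (fun l hl => by simpa using single_mem_supp (h l hl) 1) hz

lemma map_mem {S : Set (List A)} {T : Set (List B)} {f : A → B} (h : ∀ l ∈ S, l.map f ∈ T)
    {z : ListChain A} (hz : z ∈ supp S) : map f z ∈ supp T :=
  hom_mem _ _ (fun l hl => by simpa using single_mem_supp (h l hl) 1) hz

lemma bdList_mem (l : List A) : bdList l ∈ supp {l' | l'.Sublist l ∧ l'.length + 1 = l.length} := by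
  induction l with
  | nil => simp [bdList]
  | cons a l ih =>
    refine sub_mem (single_mem_supp (by simp) 1) (cone_mem (fun l' hl' => ?_) ih)
    exact ⟨hl'.1.cons_cons a, by simp [hl'.2]⟩

/-- A cycle on vertices of a simplex is the boundary of its cone. -/
lemma exists_bd_of_subset {s : Set A} {a : A} (ha : a ∈ s) {z : ListChain A}
    (hz : z ∈ supp {l : List A | ∀ x ∈ l, x ∈ s}) (h0 : bd z = 0) :
    ∃ y ∈ supp {l : List A | ∀ x ∈ l, x ∈ s}, bd y = z := by
  refine ⟨cone a z, cone_mem (fun l hl => ?_) hz, by simp [bd_cone, h0]⟩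
  simpa using ⟨ha, hl⟩

/-! ### The prism operator -/

/-- The prism between the images of a sequence under two maps of vertices. -/
def prismList (f g : A → B) : List A → ListChain B
  | [] => 0
  | a :: l => cone (f a) (cone (g a) (Finsupp.single (l.map g) 1)) - cone (f a) (prismList f g l)

/-- The prism operator of two maps of vertices. -/
def prism (f g : A → B) : ListChain A →ₗ[ℤ] ListChain B :=
  Finsupp.linearCombination ℤ (prismList f g)

lemma prism_single (f g : A → B) (l : List A) :
    prism f g (Finsupp.single l 1) = prismList f g l := by
  simp [prism]

lemma prism_cone (f g : A → B) (a : A) (x : ListChain A) :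
    prism f g (cone a x) = cone (f a) (cone (g a) (map g x)) - cone (f a) (prism f g x) := by
  have : prism f g ∘ₗ cone a =
      cone (f a) ∘ₗ cone (g a) ∘ₗ map g - cone (f a) ∘ₗ prism f g :=
    hom_ext fun l => by simp [prism_single, prismList]
  exact LinearMap.congr_fun this x

/-- Every nonempty sequence is a cone, so the formulas on cones reduce the identity to the tail. -/
lemma bd_prism (f g : A → B) (x : ListChain A) :
    bd (prism f g x) + prism f g (bd x) = map g x - map f x := by
  have : bd ∘ₗ prism f g + prism f g ∘ₗ bd = map g - map f := by
    refine hom_ext fun l => ?_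
    induction l with
    | nil => simp [prism_single, prismList]
    | cons a l ih =>
      simp only [LinearMap.comp_apply, LinearMap.add_apply, LinearMap.sub_apply] at ih ⊢
      have ih' := congrArg (cone (f a)) ih
      rw [← cone_single]
      simp only [prism_cone, bd_cone, map_cone, map_sub, map_add, bd_map] at ih' ⊢
      rw [← sub_eq_zero] at ih' ⊢
      rw [← ih']
      abel
  exact LinearMap.congr_fun this x

lemma prismList_mem (f g : A → B) (l : List A) :
    prismList f g l ∈ supp {l' | ∀ x ∈ l', x ∈ l.map f ∨ x ∈ l.map g} := by
  induction l with
  | nil => simp [prismList]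
  | cons a l ih =>
    refine sub_mem ?_ (cone_mem (fun l' hl' => ?_) ih)
    · simp only [cone_single]
      refine single_mem_supp ?_ 1
      simp only [Set.mem_ofPred_eq, List.mem_cons, List.map_cons]
      tauto
    · simp only [Set.mem_ofPred_eq, List.mem_cons, List.map_cons] at hl' ⊢
      rintro x (rfl | hx)
      · tauto
      · rcases hl' x hx with h | h <;> tauto

/-- Contiguous maps of vertices have homologous values on cycles. -/
lemma exists_bd_of_contiguous {S : Set (List A)} {T : Set (List B)} (f g : A → B)
    (h : ∀ l ∈ S, ∀ l' : List B, (∀ x ∈ l', x ∈ l.map f ∨ x ∈ l.map g) → l' ∈ T)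
    {z : ListChain A} (hz : z ∈ supp S) (h0 : bd z = 0) :
    ∃ y ∈ supp T, bd y = map g z - map f z := by
  refine ⟨prism f g z, hom_mem _ _ (fun l hl => ?_) hz, ?_⟩
  · rw [prism_single]
    exact Finsupp.supported_mono (h l hl) (prismList_mem f g l)
  · simpa [h0] using bd_prism f g z

/-! ### Acyclic carriers -/

/-- Extension of chain maps and chain homotopies along an acyclic carrier: the case `c = 1`, `u = 0`
concerns chain maps, the case `c = -1` homotopies from `0` to the chain map `u`. -/
lemma exists_hom_of_acyclic {S : Set (List A)} (hS : ∀ l ∈ S, ∀ l', l'.Sublist l → l' ∈ S)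
    (K : List A → Submodule ℤ (ListChain B))
    (hmono : ∀ l ∈ S, ∀ l', l'.Sublist l → K l' ≤ K l)
    (hacyc : ∀ l ∈ S, l ≠ [] → ∀ z ∈ K l, bd z = 0 → ∃ y ∈ K l, bd y = z)
    (u : ListChain A →ₗ[ℤ] ListChain B) (hu : ∀ l ∈ S, u (Finsupp.single l 1) ∈ K l) (c : ℤ)
    (hcomm : ∀ l ∈ S, bd (u (Finsupp.single l 1)) = -(c • u (bdList l)))
    (b : ListChain B) (hb : b ∈ K []) (hub : bd b = u (Finsupp.single [] 1)) (n : ℕ) :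
    ∃ h : ListChain A →ₗ[ℤ] ListChain B, h (Finsupp.single [] 1) = b ∧
      ∀ l ∈ S, l.length ≤ n → h (Finsupp.single l 1) ∈ K l ∧
        bd (h (Finsupp.single l 1)) = u (Finsupp.single l 1) + c • h (bdList l) := by
  classical
  induction n with
  | zero =>
    refine ⟨Finsupp.linearCombination ℤ fun _ => b, by simp, fun l hl h0 => ?_⟩
    obtain rfl : l = [] := List.length_eq_zero_iff.1 (by omega)
    simp [hb, hub, bdList]
  | succ n ih =>
    obtain ⟨h, h0, hh⟩ := ih
    have key : ∀ l : List A, l ∈ S → l.length ≤ n + 1 → l ≠ [] → ∃ y ∈ K l,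
        bd y = u (Finsupp.single l 1) + c • h (bdList l) := by
      intro l hl hln hne
      have hz : ∀ z ∈ supp {l' : List A | l'.Sublist l ∧ l'.length + 1 = l.length},
          bd (h z) = u z + c • h (bd z) := fun z hz =>
        hom_congr (f := bd ∘ₗ h) (g := u + c • (h ∘ₗ bd)) (fun l' hl' => by
          simpa [bd_single] using
            (hh l' (hS l hl l' hl'.1) (by have := hl'.2; omega)).2) hz
      refine hacyc l hl hne _ (add_mem (hu l hl) (Submodule.smul_mem _ _ ?_)) ?_
      · exact hom_mem h _ (fun l' hl' => hmono l hl l' hl'.1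
          (hh l' (hS l hl l' hl'.1) (by have := hl'.2; omega)).1) (bdList_mem l)
      -- The prescribed boundary is a cycle: the two multiples of u(∂l) cancel, and what remains
      -- contains ∂∂.
      · rw [map_add, hcomm l hl, map_smul, hz _ (bdList_mem l), ← bd_single, bd_bd]
        simp
    choose! y hyK hy using key
    -- Old values are kept up to length n, so on the terms of a boundary the new map agrees with h.
    refine ⟨Finsupp.linearCombination ℤ fun l =>
      if l.length ≤ n then h (Finsupp.single l 1) else y l, by simp [h0], fun l hl hln => ?_⟩
    have hsame : ∀ z ∈ supp {l' : List A | l'.Sublist l ∧ l'.length + 1 = l.length},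
        Finsupp.linearCombination ℤ (fun l => if l.length ≤ n then h (Finsupp.single l 1) else y l)
          z = h z := fun z hz =>
      hom_congr (fun l' hl' => by simp [show l'.length ≤ n by have := hl'.2; omega]) hz
    rw [hsame _ (bdList_mem l)]
    by_cases hle : l.length ≤ n
    · simpa [hle] using hh l hl hle
    · have hne : l ≠ [] := by rintro rfl; simp at hle
      simpa [hle] using And.intro (hyK l hl hln hne) (hy l hl hln hne)

lemma exists_length_le (z : ListChain A) : ∃ n, ∀ l ∈ z.support, l.length ≤ n :=
  ⟨z.support.sup List.length, fun _ hl => Finset.le_sup hl⟩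

end ListChain

end HigherKazhdan

end

/-! ### Small sequences in contractible metric pieces; finite subcomplexes -/

noncomputable section

namespace HigherKazhdan

namespace ListChain

variable {A B : Type*}

/-- A chain of contiguous maps of vertices has homologous ends on cycles. -/
lemma exists_bd_of_forall_contiguous {S : Set (List A)} {T : Set (List B)} (f : ℕ → A → B) (N : ℕ)
    (h : ∀ j < N, ∀ l ∈ S, ∀ l' : List B,
      (∀ x ∈ l', x ∈ l.map (f j) ∨ x ∈ l.map (f (j + 1))) → l' ∈ T)
    {z : ListChain A} (hz : z ∈ supp S) (h0 : bd z = 0) :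
    ∃ y ∈ supp T, bd y = map (f N) z - map (f 0) z := by
  induction N with
  | zero => exact ⟨0, zero_mem _, by simp⟩
  | succ N ih =>
    obtain ⟨y, hy, hyz⟩ := ih fun j hj => h j (by omega)
    obtain ⟨y', hy', hyz'⟩ := exists_bd_of_contiguous (f N) (f (N + 1)) (h N (by omega)) hz h0
    exact ⟨y + y', add_mem hy hy', by rw [map_add, hyz, hyz']; abel⟩

/-- Sequences of points of `D` with pairwise distances less than `ε`. -/
def closeLists [PseudoMetricSpace A] (D : Set A) (ε : ℝ) : Set (List A) :=
  {l | (∀ x ∈ l, x ∈ D) ∧ ∀ x ∈ l, ∀ y ∈ l, dist x y < ε}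

/-- If `D` contracts without increasing distances, then its chains of small sequences are
acyclic. -/
lemma exists_bd_of_contraction [PseudoMetricSpace A] {D : Set A} {p : A} (hp : p ∈ D)
    (σ : ℝ → A → A) (M : ℝ) (hσD : ∀ t ∈ Set.Icc (0 : ℝ) 1, ∀ x ∈ D, σ t x ∈ D)
    (hσ0 : ∀ x ∈ D, σ 0 x = x) (hσ1 : ∀ x ∈ D, σ 1 x = p)
    (hdist : ∀ t ∈ Set.Icc (0 : ℝ) 1, ∀ t' ∈ Set.Icc (0 : ℝ) 1, ∀ x ∈ D, ∀ y ∈ D,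
      dist (σ t x) (σ t' y) ≤ dist x y + |t - t'| * M)
    {ε : ℝ} (hε : 0 < ε) {z : ListChain A} (hz : z ∈ supp (closeLists D ε)) (h0 : bd z = 0) :
    ∃ y ∈ supp (closeLists D ε), bd y = z := by
  classical
  -- Only finitely many points occur in z, so their distances stay below some η < ε. This leaves
  -- room ε - η for motion in time.
  obtain ⟨η, hηε, hη0, hη⟩ : ∃ η < ε, 0 ≤ η ∧
      ∀ l ∈ z.support, ∀ x ∈ l, ∀ y ∈ l, dist x y ≤ η := by
    let P : Finset A := z.support.biUnion List.toFinset
    let Q : Finset ℝ := insert 0 (((P ×ˢ P).image fun q => dist q.1 q.2).filter (· < ε))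
    have hQ : Q.Nonempty := Finset.insert_nonempty _ _
    refine ⟨Q.max' hQ, ?_, Finset.le_max' _ _ (Finset.mem_insert_self _ _), ?_⟩
    · rw [Finset.max'_lt_iff]
      intro y hy
      simp only [Q, Finset.mem_insert, Finset.mem_filter] at hy
      rcases hy with rfl | hy
      exacts [hε, hy.2]
    · intro l hl x hx y hy
      have hmem : dist x y ∈ Q := by
        simp only [Q, P, Finset.mem_insert, Finset.mem_filter, Finset.mem_image,
          Finset.mem_product, Finset.mem_biUnion, List.mem_toFinset]
        exact Or.inr ⟨⟨(x, y), ⟨⟨l, hl, hx⟩, ⟨l, hl, hy⟩⟩, rfl⟩, (hz hl).2 x hx y hy⟩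
      exact Finset.le_max' _ _ hmem
  -- With N time steps, consecutive maps differ by an extra |M| / N < ε - η, hence are contiguous at
  -- scale ε.
  obtain ⟨N, hN⟩ := exists_nat_gt (|M| / (ε - η))
  have hN0 : (0 : ℝ) < N := lt_of_le_of_lt (div_nonneg (abs_nonneg _) (by linarith)) hN
  have hstep : 1 / (N : ℝ) * |M| < ε - η := by
    rw [div_lt_iff₀ (by linarith)] at hN
    rw [one_div, inv_mul_lt_iff₀ hN0]
    exact hN
  have hI : ∀ j ≤ N, (j : ℝ) / N ∈ Set.Icc (0 : ℝ) 1 := fun j hj =>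
    ⟨by positivity, (div_le_one hN0).2 (by exact_mod_cast hj)⟩
  let S : Set (List A) := {l | (∀ x ∈ l, x ∈ D) ∧ ∀ x ∈ l, ∀ y ∈ l, dist x y ≤ η}
  have hzS : z ∈ supp S := fun l hl => ⟨(hz hl).1, hη l hl⟩
  obtain ⟨y, hy, hyz⟩ := exists_bd_of_forall_contiguous (S := S) (T := closeLists D ε)
    (fun j => σ (j / N)) N (by
      intro j hj l hl l' hl'
      have hpt : ∀ x ∈ l', ∃ i : ℕ, (i = j ∨ i = j + 1) ∧ ∃ w ∈ l, σ (i / N) w = x := by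
        intro x hx
        rcases hl' x hx with h | h
        · obtain ⟨w, hw, rfl⟩ := List.mem_map.1 h
          exact ⟨j, Or.inl rfl, w, hw, rfl⟩
        · obtain ⟨w, hw, rfl⟩ := List.mem_map.1 h
          exact ⟨j + 1, Or.inr rfl, w, hw, rfl⟩
      have hle : ∀ i : ℕ, (i = j ∨ i = j + 1) → i ≤ N := by omega
      refine ⟨fun x hx => ?_, fun x hx y hy => ?_⟩
      · obtain ⟨i, hi, w, hw, rfl⟩ := hpt x hx
        exact hσD _ (hI i (hle i hi)) w (hl.1 w hw)
      · obtain ⟨i, hi, w, hw, rfl⟩ := hpt x hx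
        obtain ⟨i', hi', w', hw', rfl⟩ := hpt y hy
        have habs : |(i : ℝ) / N - i' / N| ≤ 1 / N := by
          rw [← sub_div, abs_div, abs_of_pos hN0]
          refine div_le_div_of_nonneg_right ?_ hN0.le
          rw [abs_le]
          constructor <;> rcases hi with rfl | rfl <;> rcases hi' with rfl | rfl <;>
            push_cast <;> linarith
        calc dist (σ (i / N) w) (σ (i' / N) w')
            ≤ dist w w' + |(i : ℝ) / N - i' / N| * M :=
              hdist _ (hI i (hle i hi)) _ (hI i' (hle i' hi')) _ (hl.1 w hw) _ (hl.1 w' hw')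
          _ ≤ η + 1 / N * |M| := by
              refine add_le_add (hl.2 w hw w' hw') ?_
              exact (mul_le_mul_of_nonneg_left (le_abs_self M) (abs_nonneg _)).trans
                (mul_le_mul_of_nonneg_right habs (abs_nonneg M))
          _ < ε := by linarith) hzS h0
  have hmap0 : map (σ ((0 : ℕ) / N)) z = z := by
    refine hom_congr (g := LinearMap.id) (fun l hl => ?_) hzS
    have : l.map (σ ((0 : ℕ) / N)) = l := by
      conv_rhs => rw [← List.map_id l]
      exact List.map_congr_left fun x hx => by simpa using hσ0 x (hl.1 x hx)
    simp only [map_single, LinearMap.id_apply, this]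
  -- At time 1 all points have become p, and a cycle on one point is a boundary.
  obtain ⟨y', hy', hyz'⟩ := exists_bd_of_subset (s := {p}) (Set.mem_singleton p)
    (z := map (σ ((N : ℕ) / N)) z) (map_mem (S := S) (T := {l | ∀ x ∈ l, x ∈ ({p} : Set A)})
      (fun l hl x hx => by
        obtain ⟨w, hw, rfl⟩ := List.mem_map.1 hx
        rw [div_self hN0.ne']
        exact hσ1 w (hl.1 w hw)) hzS) (by rw [bd_map, h0, map_zero])
  have hsub : {l : List A | ∀ x ∈ l, x ∈ ({p} : Set A)} ⊆ closeLists D ε := by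
    refine fun l hl => ⟨fun x hx => ?_, fun x hx w hw => ?_⟩
    · rw [Set.mem_singleton_iff.1 (hl x hx)]
      exact hp
    · rw [Set.mem_singleton_iff.1 (hl x hx), Set.mem_singleton_iff.1 (hl w hw), dist_self]
      exact hε
  refine ⟨y' - y, sub_mem (Finsupp.supported_mono hsub hy') hy, ?_⟩
  rw [map_sub, hyz, hyz', hmap0]
  abel

end ListChain

/-! ### The realization of a finite subcomplex -/

section Realization

variable {V : Type} (X : AbstractSimplicialComplex V)

lemma continuous_closedCell_val (s : X.faces) :
    Continuous (fun x : ClosedCell X s.1 => x.1) :=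
  continuous_iff_coinduced_le.2 (le_iSup (fun s : X.faces => TopologicalSpace.coinduced
    (fun x : ClosedCell X s.1 => x.1) inferInstance) s)

/-- The weak topology is finer than that of coordinates, so open stars of vertices are open. -/
lemma continuous_realization_coord (v : V) : Continuous (fun x : Realization X => x.1 v) :=
  continuous_iSup_dom.2 fun _ => continuous_coinduced_dom.2
    ((continuous_apply v).comp continuous_induced_dom)

lemma Realization.exists_pos (x : Realization X) : ∃ v, 0 < x.1 v := by
  obtain ⟨s, -, h0, -, h1⟩ := x.2
  by_contra! h
  rw [Finset.sum_eq_zero fun v _ => le_antisymm (h v) (h0 v)] at h1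
  exact zero_ne_one h1

lemma Realization.exists_face (x : Realization X) : ∃ s ∈ X.faces, ∀ v, 0 < x.1 v → v ∈ s := by
  obtain ⟨s, hs, -, h1, -⟩ := x.2
  exact ⟨s, hs, fun v hv => by_contra fun h => hv.ne' (h1 v h)⟩

variable (W : Finset V)

/-- The simplex with vertex set `s`, in barycentric coordinates on `W`. -/
def finiteCell (s : Finset V) : Set (W → ℝ) :=
  {x | (∀ v, 0 ≤ x v) ∧ (∀ v : W, v.1 ∉ s → x v = 0) ∧ ∑ v, x v = 1}

/-- The realization of the full subcomplex on a finite set of vertices. -/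
def finiteRealization : Set (W → ℝ) := {x | ∃ s ∈ X.faces, s ⊆ W ∧ x ∈ finiteCell W s}

variable {W}

lemma finiteCell_le_one {s : Finset V} {x : W → ℝ} (hx : x ∈ finiteCell W s) (v : W) : x v ≤ 1 := by
  rw [← hx.2.2]
  exact Finset.single_le_sum (f := x) (fun v _ => hx.1 v) (Finset.mem_univ v)

lemma isClosed_finiteCell (s : Finset V) : IsClosed (finiteCell W s) := by
  have h1 : IsClosed {x : W → ℝ | ∀ v, 0 ≤ x v} := by
    simp only [Set.ofPred_forall]
    exact isClosed_iInter fun v => isClosed_le continuous_const (continuous_apply v)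
  have h2 : IsClosed {x : W → ℝ | ∀ v : W, v.1 ∉ s → x v = 0} := by
    simp only [Set.ofPred_forall]
    exact isClosed_iInter fun v => isClosed_iInter fun _ =>
      isClosed_eq (continuous_apply v) continuous_const
  have h3 : IsClosed {x : W → ℝ | ∑ v, x v = 1} :=
    isClosed_eq (continuous_finsetSum _ fun v _ => continuous_apply v) continuous_const
  exact h1.inter (h2.inter h3)

lemma isCompact_finiteCell (s : Finset V) : IsCompact (finiteCell W s) :=
  (isCompact_Icc (a := (0 : W → ℝ)) (b := 1)).of_isClosed_subset (isClosed_finiteCell s)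
    fun _ hx => ⟨hx.1, finiteCell_le_one hx⟩

lemma finiteCell_convex {s : Finset V} {x y : W → ℝ} (hx : x ∈ finiteCell W s)
    (hy : y ∈ finiteCell W s) {t : ℝ} (ht : t ∈ Set.Icc (0 : ℝ) 1) :
    (1 - t) • x + t • y ∈ finiteCell W s := by
  have h1 : 0 ≤ 1 - t := by linarith [ht.2]
  refine ⟨fun v => ?_, fun v hv => ?_, ?_⟩
  · have := hx.1 v
    have := hy.1 v
    have := ht.1
    simp only [Pi.add_apply, Pi.smul_apply, smul_eq_mul]
    positivity
  · simp [hx.2.1 v hv, hy.2.1 v hv]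
  · simp only [Pi.add_apply, Pi.smul_apply, smul_eq_mul, Finset.sum_add_distrib,
      ← Finset.mul_sum, hx.2.2, hy.2.2]
    ring

lemma isCompact_finiteRealization : IsCompact (finiteRealization X W) := by
  have : finiteRealization X W =
      ⋃ s ∈ {s : Finset V | s ∈ X.faces ∧ s ⊆ W}, finiteCell W s := by
    ext x
    simp [finiteRealization, and_assoc]
  rw [this]
  exact ((W.powerset.finite_toSet).subset fun s hs => by simpa using hs.2).isCompact_biUnion
    fun s _ => isCompact_finiteCell s

open Classical in
/-- The inclusion of the realization of a finite subcomplex. -/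
def finiteRealizationIncl (x : finiteRealization X W) : Realization X :=
  ⟨fun v => if h : v ∈ W then x.1 ⟨v, h⟩ else 0, by
    obtain ⟨s, hs, hsW, h0, h1, h2⟩ := x.2
    refine ⟨s, hs, fun v => ?_, fun v hv => ?_, ?_⟩
    · dsimp only
      split_ifs
      exacts [h0 _, le_rfl]
    · dsimp only
      split_ifs with h
      exacts [h1 ⟨v, h⟩ hv, rfl]
    · rw [Finset.sum_subset hsW, ← h2, ← Finset.sum_attach]
      · exact Finset.sum_congr rfl fun v _ => by simp
      · intro v hv hvs
        simpa [hv] using h1 ⟨v, hv⟩ hvs⟩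

lemma finiteRealizationIncl_pos {x : finiteRealization X W} {v : V}
    (h : 0 < (finiteRealizationIncl X x).1 v) : ∃ hv : v ∈ W, 0 < x.1 ⟨v, hv⟩ := by
  by_cases hv : v ∈ W
  · exact ⟨hv, by simpa [finiteRealizationIncl, hv] using h⟩
  · simp [finiteRealizationIncl, hv] at h

-- Finitely many closed cells cover the source. On each of them the map lands in one closed simplex
-- of |X|, whose topology is the coordinate one.
open Classical in
lemma continuous_finiteRealizationIncl : Continuous (finiteRealizationIncl X (W := W)) := by
  have : Finite {s : Finset V // s ∈ X.faces ∧ s ⊆ W} :=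
    ((W.powerset.finite_toSet).subset fun s (hs : s ∈ X.faces ∧ s ⊆ W) => by
      simpa using hs.2).to_subtype
  refine LocallyFinite.continuous
    (f := fun s : {s : Finset V // s ∈ X.faces ∧ s ⊆ W} =>
      {x : finiteRealization X W | x.1 ∈ finiteCell W s.1})
    (locallyFinite_of_finite _) ?_
    (fun s => (isClosed_finiteCell s.1).preimage continuous_subtype_val) fun s => ?_
  · ext x
    obtain ⟨s, hs, hsW, hx⟩ := x.2
    simpa using ⟨s, ⟨hs, hsW⟩, hx⟩
  · rw [continuousOn_iff_continuous_domRestrict]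
    have hmem : ∀ x : {x : finiteRealization X W | x.1 ∈ finiteCell W s.1}, ∀ v, v ∉ s.1 →
        (finiteRealizationIncl X x.1).1 v = 0 := by
      intro x v hv
      by_cases h : v ∈ W
      · simpa [finiteRealizationIncl, h] using x.2.2.1 ⟨v, h⟩ hv
      · simp [finiteRealizationIncl, h]
    let g : {x : finiteRealization X W | x.1 ∈ finiteCell W s.1} → ClosedCell X s.1 :=
      fun x => ⟨finiteRealizationIncl X x.1, hmem x⟩
    suffices hg : Continuous g from (continuous_closedCell_val X ⟨s.1, s.2.1⟩).comp hg
    refine continuous_induced_rng.2 (continuous_pi fun v => ?_)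
    change Continuous fun x : {x : finiteRealization X W | x.1 ∈ finiteCell W s.1} =>
      if h : v ∈ W then x.1.1 ⟨v, h⟩ else 0
    by_cases h : v ∈ W
    · simp only [h, dif_pos]
      exact (continuous_apply (⟨v, h⟩ : W)).comp
        (continuous_subtype_val.comp continuous_subtype_val)
    · simp only [h, dif_neg, not_false_eq_true]
      exact continuous_const

end Realization

end HigherKazhdan

end

noncomputable section

namespace HigherKazhdan

/-! ### Acyclicity of contractible complexes -/

section Acyclic

open ListChain

variable {V : Type} (X : AbstractSimplicialComplex V)

/-- Sequences of vertices, possibly with repetitions, lying in a simplex. -/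
def faceLists : Set (List V) := {l | ∃ s ∈ X.faces, ∀ v ∈ l, v ∈ s}

variable {X}

/-- The open stars of vertices cover |X|. A Lebesgue number of the cover pulled back to the compact
source gives each δ-ball a vertex whose star contains its image. -/
lemma exists_vertex_of_homotopy {W : Finset V} (G : unitInterval × finiteRealization X W → Realization X)
    (hG : Continuous G) : ∃ δ > 0, ∃ ψ : unitInterval × finiteRealization X W → V,
      ∀ q q', dist q' q < δ → 0 < (G q').1 (ψ q) := by
  have : CompactSpace (finiteRealization X W) :=
    isCompact_iff_compactSpace.1 (isCompact_finiteRealization X)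
  obtain ⟨δ, hδ, h⟩ := lebesgue_number_lemma_of_metric
    (isCompact_univ (X := unitInterval × finiteRealization X W)) (c := fun v => {q | 0 < (G q).1 v})
    (fun v => isOpen_lt continuous_const ((continuous_realization_coord X v).comp hG))
    (fun q _ => Set.mem_iUnion.2 (G q).exists_pos)
  choose ψ hψ using fun q => h q (Set.mem_univ q)
  exact ⟨δ, hδ, ψ, fun q q' hq => hψ q hq⟩

/-- Points of the finite realization supported on the vertices of the sequence `l`. -/
def cellOfList (W : Finset V) (l : List V) : Set (finiteRealization X W) :=
  {x | ∀ v : W, v.1 ∉ l → x.1 v = 0}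

/-- The straight-line contraction of a closed cell to its vertex a does not increase distances, and
moves points with speed at most 1 in the sup metric. -/
lemma exists_bd_cellOfList {W : Finset V} {ε : ℝ} (hε : 0 < ε) {l : List V} (hne : l ≠ [])
    {s : Finset V} (hs : s ∈ X.faces) (hsW : s ⊆ W) (hl : ∀ v ∈ l, v ∈ s)
    {z : ListChain (finiteRealization X W)} (hz : z ∈ supp (closeLists (cellOfList W l) ε))
    (h0 : bd z = 0) : ∃ y ∈ supp (closeLists (cellOfList W l) ε), bd y = z := by
  classical
  obtain ⟨a, l', rfl⟩ := List.exists_cons_of_ne_nil hne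
  have haW : a ∈ W := hsW (hl a (by simp))
  have hcell : ∀ x ∈ cellOfList (X := X) W (a :: l'), x.1 ∈ finiteCell W s := by
    intro x hx
    obtain ⟨_, -, -, h⟩ := x.2
    exact ⟨h.1, fun v hv => hx v fun hv' => hv (hl v hv'), h.2.2⟩
  have hpcell : Pi.single (⟨a, haW⟩ : W) (1 : ℝ) ∈ finiteCell W s := by
    refine ⟨fun v => ?_, fun v hv => ?_, by simp⟩
    · by_cases h : v = ⟨a, haW⟩
      · subst h; simp
      · simp [Pi.single_eq_of_ne h]
    · refine Pi.single_eq_of_ne ?_ _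
      rintro rfl
      exact hv (hl a (by simp))
  let p : finiteRealization X W := ⟨Pi.single ⟨a, haW⟩ 1, s, hs, hsW, hpcell⟩
  have hp : p ∈ cellOfList W (a :: l') := fun v hv =>
    Pi.single_eq_of_ne (fun h => hv (by simp [h])) _
  have hcomb : ∀ t ∈ Set.Icc (0 : ℝ) 1, ∀ x ∈ cellOfList (X := X) W (a :: l'),
      (1 - t) • x.1 + t • p.1 ∈ finiteRealization X W := fun t ht x hx =>
    ⟨s, hs, hsW, finiteCell_convex (hcell x hx) hpcell ht⟩
  -- Off the cell the segment to p can leave the realization. The default value p plays no role,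
  -- since only points of the cell and times in [0, 1] matter.
  let σ : ℝ → finiteRealization X W → finiteRealization X W := fun t x =>
    if h : (1 - t) • x.1 + t • p.1 ∈ finiteRealization X W then ⟨_, h⟩ else p
  have hσ : ∀ t ∈ Set.Icc (0 : ℝ) 1, ∀ x ∈ cellOfList (X := X) W (a :: l'),
      (σ t x).1 = (1 - t) • x.1 + t • p.1 := fun t ht x hx => by
    simp only [σ, dif_pos (hcomb t ht x hx)]
  refine exists_bd_of_contraction hp σ 1 (fun t ht x hx v hv => ?_) (fun x hx => ?_)
    (fun x hx => ?_) (fun t ht t' ht' x hx y hy => ?_) hε hz h0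
  · rw [hσ t ht x hx]
    simp [hx v hv, hp v hv]
  · exact Subtype.ext (by rw [hσ 0 (by simp) x hx]; simp)
  · exact Subtype.ext (by rw [hσ 1 (by simp) x hx]; simp)
  · rw [Subtype.dist_eq, hσ t ht x hx, hσ t' ht' y hy, Subtype.dist_eq, dist_eq_norm,
      dist_eq_norm]
    have heq : (1 - t) • x.1 + t • p.1 - ((1 - t') • y.1 + t' • p.1) =
        (1 - t) • (x.1 - y.1) + (t' - t) • (y.1 - p.1) := by
      module
    have hyp : ‖y.1 - p.1‖ ≤ 1 := by
      rw [pi_norm_le_iff_of_nonneg zero_le_one]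
      intro v
      have h1 := (hcell y hy).1 v
      have h2 := finiteCell_le_one (hcell y hy) v
      have h3 := hpcell.1 v
      have h4 := finiteCell_le_one hpcell v
      rw [Real.norm_eq_abs, Pi.sub_apply, abs_le]
      constructor <;> linarith
    rw [heq]
    refine (norm_add_le _ _).trans (add_le_add ?_ ?_)
    · rw [norm_smul]
      refine mul_le_of_le_one_left (norm_nonneg _) ?_
      rw [Real.norm_eq_abs, abs_le]
      constructor <;> linarith [ht.1, ht.2]
    · rw [norm_smul, Real.norm_eq_abs, abs_sub_comm]
      exact mul_le_mul_of_nonneg_left hyp (abs_nonneg _)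

/-- Replacing simplices by chains of small sequences of their points. -/
lemma exists_subdivision {W : Finset V} {ε : ℝ} (hε : 0 < ε) (n : ℕ) :
    ∃ τ : ListChain V →ₗ[ℤ] ListChain (finiteRealization X W),
      τ (Finsupp.single [] 1) = Finsupp.single [] 1 ∧
      ∀ l : List V, (∃ s ∈ X.faces, s ⊆ W ∧ ∀ v ∈ l, v ∈ s) → l.length ≤ n →
        τ (Finsupp.single l 1) ∈ supp (closeLists (cellOfList W l) ε) ∧
          bd (τ (Finsupp.single l 1)) = τ (bdList l) := by
  -- A sequence is carried by the small sequences in the cell it spans. For the empty sequence this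
  -- cell has no points, and only the empty sequence of points remains.
  obtain ⟨τ, h0, h⟩ := exists_hom_of_acyclic
    (S := {l : List V | ∃ s ∈ X.faces, s ⊆ W ∧ ∀ v ∈ l, v ∈ s})
    (fun l hl l' hl' => by
      obtain ⟨s, hs, hsW, hl⟩ := hl
      exact ⟨s, hs, hsW, fun v hv => hl v (hl'.subset hv)⟩)
    (fun l => supp (closeLists (cellOfList (X := X) W l) ε))
    (fun l _ l' hl' => Finsupp.supported_mono fun m hm => by
      exact ⟨fun x hx v hv => hm.1 x hx v fun h => hv (hl'.subset h), hm.2⟩)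
    (fun l hl hne z hz hz0 => by
      obtain ⟨s, hs, hsW, hl⟩ := hl
      exact exists_bd_cellOfList hε hne hs hsW hl hz hz0)
    0 (fun _ _ => zero_mem _) 1 (by simp) (Finsupp.single [] 1)
    (single_mem_supp (S := closeLists (cellOfList (X := X) W []) ε) ⟨by simp, by simp⟩ 1)
    (by simp) n
  exact ⟨τ, h0, fun l hl hn => by simpa using h l hl hn⟩

/-- The chains of a contractible simplicial complex are exact. -/
theorem exists_bd_of_contractible [ContractibleSpace (Realization X)] {z : ListChain V}
    (hz : z ∈ supp (faceLists X)) (hz0 : bd z = 0) : ∃ y ∈ supp (faceLists X), bd y = z := by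
  classical
  choose! c hcX hc using fun (l : List V) (hl : l ∈ z.support) => hz hl
  -- The cycle lives on finitely many vertices, where the realization is a compact metric space.
  let W : Finset V := z.support.biUnion c
  obtain ⟨n, hn⟩ := exists_length_le z
  obtain ⟨x₀, ⟨F⟩⟩ := id_nullhomotopic (Realization X)
  let G : unitInterval × finiteRealization X W → Realization X := fun q => F (q.1, finiteRealizationIncl X q.2)
  have hG : Continuous G := F.continuous.comp
    (continuous_fst.prodMk ((continuous_finiteRealizationIncl X).comp continuous_snd))
  have hG0 : ∀ x, G (0, x) = finiteRealizationIncl X x := fun x => F.apply_zero _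
  have hG1 : ∀ x, G (1, x) = x₀ := fun x => F.apply_one _
  obtain ⟨δ, hδ, ψ, hψ⟩ := exists_vertex_of_homotopy G hG
  obtain ⟨s₀, hs₀, hx₀⟩ := x₀.exists_face
  obtain ⟨N, hN⟩ := exists_nat_gt (1 / δ)
  have hN0 : (0 : ℝ) < N := lt_trans (by positivity) hN
  have hNδ : 1 / (N : ℝ) < δ := (one_div_lt hδ hN0).1 hN
  let t : ℕ → unitInterval := fun j => Set.projIcc 0 1 zero_le_one ((j : ℝ) / N)
  have ht0 : t 0 = 0 := Subtype.ext (by simp [t])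
  have ht1 : t N = 1 := Subtype.ext (by simp [t, div_self hN0.ne'])
  have htd : ∀ j, dist (t j) (t (j + 1)) < δ := fun j => by
    refine lt_of_le_of_lt ?_ hNδ
    rw [Subtype.dist_eq, Real.dist_eq]
    refine (Set.abs_projIcc_sub_projIcc zero_le_one).trans (le_of_eq ?_)
    rw [← sub_div, abs_div, abs_of_pos hN0, Nat.cast_add_one]
    simp
  let f : ℕ → finiteRealization X W → V := fun j x => ψ (t j, x)
  -- subdivision
  let S : Set (List V) := {l | (∃ s ∈ X.faces, s ⊆ W ∧ ∀ v ∈ l, v ∈ s) ∧ l.length ≤ n}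
  have hSsub : ∀ l ∈ S, ∀ l', l'.Sublist l → l' ∈ S := by
    rintro l ⟨⟨s, hs, hsW, hl⟩, hln⟩ l' hl'
    exact ⟨⟨s, hs, hsW, fun v hv => hl v (hl'.subset hv)⟩, hl'.length_le.trans hln⟩
  have hzS : z ∈ supp S := fun l hl =>
    ⟨⟨c l, hcX l hl, Finset.subset_biUnion_of_mem c hl, hc l hl⟩, hn l hl⟩
  obtain ⟨τ, hτ0, hτ⟩ := exists_subdivision (X := X) (W := W) hδ n
  have hτbd : ∀ w ∈ supp S, bd (τ w) = τ (bd w) := fun w hw =>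
    hom_congr (f := bd ∘ₗ τ) (g := τ ∘ₗ bd)
      (fun l hl => by simpa [bd_single] using (hτ l hl.1 hl.2).2) hw
  have hτz0 : bd (τ z) = 0 := by rw [hτbd z hzS, hz0, map_zero]
  have hτz : τ z ∈ supp (closeLists (Set.univ : Set (finiteRealization X W)) δ) :=
    hom_mem _ _ (fun l hl => Finsupp.supported_mono (fun m hm => by exact ⟨fun _ _ => trivial, hm.2⟩)
      (hτ l hl.1 hl.2).1) hzS
  -- the subdivided cycle, pushed along the homotopy
  obtain ⟨y₁, hy₁, hyz₁⟩ := exists_bd_of_forall_contiguous (T := faceLists X) f N (by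
    intro j hj m hm l' hl'
    rcases m with _ | ⟨x, m⟩
    -- The empty sequence of points imposes no vertices, so any face will do.
    · exact ⟨s₀, hs₀, fun v hv => by simpa using hl' v hv⟩
    -- All other points and both times are within δ of (t j, x), so every chosen vertex has positive
    -- coordinate at its image and lies in one face.
    · obtain ⟨s, hs, hsG⟩ := (G (t j, x)).exists_face
      refine ⟨s, hs, fun v hv => hsG v ?_⟩
      rcases hl' v hv with h | h
      · obtain ⟨w, hw, rfl⟩ := List.mem_map.1 h
        refine hψ _ _ ?_
        rw [Prod.dist_eq, dist_self]
        exact max_lt hδ (hm.2 _ (by simp) _ hw)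
      · obtain ⟨w, hw, rfl⟩ := List.mem_map.1 h
        exact hψ _ _ (max_lt (htd j) (hm.2 _ (by simp) _ hw))) hτz hτz0
  -- its end lies in a simplex
  obtain ⟨a, ha⟩ := X.isRelLowerSet_faces hs₀ |>.1
  obtain ⟨y₂, hy₂, hyz₂⟩ := exists_bd_of_subset (s := (s₀ : Set V)) (a := a) ha
    (z := map (f N) (τ z)) (map_mem (T := {l | ∀ x ∈ l, x ∈ (s₀ : Set V)})
      (fun m hm v hv => by
        obtain ⟨w, hw, rfl⟩ := List.mem_map.1 hv
        have := hψ (t N, w) (t N, w) (by simpa using hδ)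
        rw [ht1, hG1] at this
        exact hx₀ _ (by simpa only [f, ht1] using this)) hτz) (by rw [bd_map, hτz0, map_zero])
  -- its start is homologous to the original cycle
  have hf0 : ∀ l : List V, ∀ x ∈ cellOfList (X := X) W l, f 0 x ∈ l := by
    intro l x hx
    have := hψ (t 0, x) (t 0, x) (by simpa using hδ)
    rw [ht0, hG0] at this
    obtain ⟨hv, hpos⟩ := finiteRealizationIncl_pos X this
    by_contra hcon
    simp only [f, ht0] at hcon
    exact hpos.ne' (hx ⟨_, hv⟩ hcon)
  -- Both the composite and the identity send l to chains on the vertices of l. This carrier is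
  -- acyclic by coning, so the two chain maps are homotopic.
  obtain ⟨h, -, hh⟩ := exists_hom_of_acyclic hSsub
    (fun l => supp {m : List V | ∀ v ∈ m, v ∈ l})
    (fun l _ l' hl' => Finsupp.supported_mono fun m hm v hv => hl'.subset (hm v hv))
    (fun l hl hne w hw hw0 => by
      obtain ⟨a, l', rfl⟩ := List.exists_cons_of_ne_nil hne
      exact exists_bd_of_subset (s := {v | v ∈ a :: l'}) (a := a) (by simp) hw hw0)
    (map (f 0) ∘ₗ τ - LinearMap.id)
    (fun l hl => sub_mem (map_mem (fun m hm v hv => by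
      obtain ⟨x, hx, rfl⟩ := List.mem_map.1 hv
      exact hf0 l x (hm.1 x hx)) (hτ l hl.1 hl.2).1) (single_mem_supp (fun v hv => hv) 1))
    (-1) (fun l hl => by
      simp [bd_map, (hτ l hl.1 hl.2).2, bd_single]) 0 (zero_mem _) (by simp [hτ0]) n
  have hhz : bd (h z) = map (f 0) (τ z) - z := by
    have := hom_congr (f := bd ∘ₗ h) (g := (map (f 0) ∘ₗ τ - LinearMap.id) - h ∘ₗ bd)
      (fun l hl => by
        rw [LinearMap.comp_apply, (hh l hl hl.2).2]
        simp [bd_single, sub_eq_add_neg]) hzS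
    simpa [hz0] using this
  have hhmem : h z ∈ supp (faceLists X) := hom_mem _ _ (fun l hl =>
    Finsupp.supported_mono (fun m hm => by
      obtain ⟨⟨s, hs, -, hls⟩, -⟩ := hl
      exact ⟨s, hs, fun v hv => hls v (hm v hv)⟩) (hh l hl hl.2).1) hzS
  refine ⟨y₂ - y₁ - h z, sub_mem (sub_mem (Finsupp.supported_mono
    (fun m hm => by exact ⟨s₀, hs₀, hm⟩) hy₂) hy₁) hhmem, ?_⟩
  rw [map_sub, map_sub, hyz₁, hyz₂, hhz]
  abel

end Acyclic

end HigherKazhdan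

end

noncomputable section

namespace HigherKazhdan

/-! ### Oriented simplicial chains -/

/-- Composing τ with the cycles that move i and τ i to the front gives a permutation fixing 0. Its
restriction is τ', and the two cycles contribute the signs. -/
lemma exists_perm_succAbove {n : ℕ} (τ : Equiv.Perm (Fin (n + 1))) (i : Fin (n + 1)) :
    ∃ τ' : Equiv.Perm (Fin n), (∀ j, τ (i.succAbove j) = (τ i).succAbove (τ' j)) ∧
      ((Equiv.Perm.sign τ' : ℤˣ) : ℤ) =
        (-1) ^ (i : ℕ) * (-1) ^ (τ i : ℕ) * ((Equiv.Perm.sign τ : ℤˣ) : ℤ) := by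
  let ρ : Equiv.Perm (Fin (n + 1)) := (τ i).cycleRange * τ * i.cycleRange⁻¹
  obtain ⟨⟨p, τ'⟩, hρ⟩ := Equiv.Perm.decomposeFin.symm.surjective ρ
  have hcyc : ∀ (k : Fin (n + 1)) (x : Fin (n + 1)), k.cycleRange⁻¹ x = k.cycleRange.symm x :=
    fun _ _ => rfl
  have hρ0 : ρ 0 = 0 := by
    simp only [ρ, Equiv.Perm.mul_apply, hcyc, Fin.cycleRange_symm_zero]
    exact Fin.cycleRange_self _
  have hp : p = 0 := by
    rw [← hρ0, ← hρ, Equiv.Perm.decomposeFin_symm_apply_zero]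
  subst hp
  refine ⟨τ', fun j => ?_, ?_⟩
  · have h1 : ρ j.succ = (τ' j).succ := by
      rw [← hρ, Equiv.Perm.decomposeFin_symm_apply_succ]
      simp
    rw [← Fin.cycleRange_symm_succ (τ i), ← h1]
    simp only [ρ, Equiv.Perm.mul_apply, hcyc, Fin.cycleRange_symm_succ, Equiv.symm_apply_apply]
  · have h2 : Equiv.Perm.sign ρ = Equiv.Perm.sign τ' := by
      rw [← hρ, Equiv.Perm.decomposeFin.symm_sign]
      simp
    rw [← h2]
    simp only [ρ, map_mul, map_inv, Fin.sign_cycleRange, Units.val_mul, Units.val_pow_eq_pow_val,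
      Units.val_neg, Units.val_one, Int.units_inv_eq_self]
    ring

section OrdChain

variable {V : Type} [DecidableEq V] {X : AbstractSimplicialComplex V} {k : ℕ}
  {M : Type*} [AddCommGroup M]

@[ext] lemma OrdSimplex.ext {σ τ : OrdSimplex X k} (h : ∀ i, σ.1 i = τ.1 i) : σ = τ :=
  Subtype.ext (funext h)

/-- The ordered simplex given by distinct vertices of a simplex. -/
def OrdSimplex.mk (v : Fin (k + 1) → V)
    (h : Function.Injective v ∧ Finset.univ.image v ∈ X.faces) : OrdSimplex X k := ⟨v, h⟩

lemma OrdSimplex.face_reorder (σ : OrdSimplex X (k + 1)) (τ : Equiv.Perm (Fin (k + 2)))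
    (i : Fin (k + 2)) {τ' : Equiv.Perm (Fin (k + 1))}
    (h : ∀ j, τ (i.succAbove j) = (τ i).succAbove (τ' j)) :
    (σ.reorder τ).face i = (σ.face (τ i)).reorder τ' :=
  OrdSimplex.ext fun j => congrArg σ.1 (h j)

/-- Alternating functions on ordered simplices. -/
def IsAlternating (f : OrdSimplex X k → M) : Prop :=
  ∀ (σ : OrdSimplex X k) (τ : Equiv.Perm (Fin (k + 1))),
    f (σ.reorder τ) = (Equiv.Perm.sign τ : ℤ) • f σ

lemma IsAlternating.coboundary {f : OrdSimplex X k → M} (hf : IsAlternating f) :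
    IsAlternating fun σ : OrdSimplex X (k + 1) =>
      ∑ i : Fin (k + 2), (-1 : ℤ) ^ (i : ℕ) • f (σ.face i) := by
  intro σ τ
  simp only
  rw [Finset.smul_sum]
  conv_rhs => rw [← Equiv.sum_comp τ]
  refine Finset.sum_congr rfl fun i _ => ?_
  obtain ⟨τ', h, hsign⟩ := exists_perm_succAbove τ i
  rw [OrdSimplex.face_reorder σ τ i h, hf, hsign, smul_smul, smul_smul]
  congr 1
  have : ((-1 : ℤ) ^ (i : ℕ)) * (-1) ^ (i : ℕ) = 1 := by
    rw [← mul_pow]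
    simp
  linear_combination ((-1) ^ (τ i : ℕ) * (Equiv.Perm.sign τ : ℤ)) * this

variable (X k) in
/-- The relations expressing that reordering a simplex multiplies it by the sign. -/
def ordRelations : Submodule ℤ (OrdSimplex X k →₀ ℤ) :=
  Submodule.span ℤ {x | ∃ (σ : OrdSimplex X k) (τ : Equiv.Perm (Fin (k + 1))),
    x = Finsupp.single (σ.reorder τ) 1 - (Equiv.Perm.sign τ : ℤ) • Finsupp.single σ 1}

variable (X k) in
/-- Oriented simplicial chains. -/
abbrev OrdChain : Type := (OrdSimplex X k →₀ ℤ) ⧸ ordRelations X k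

namespace OrdChain

/-- The chain of an ordered simplex. -/
def of (σ : OrdSimplex X k) : OrdChain X k := (ordRelations X k).mkQ (Finsupp.single σ 1)

lemma of_alternating : IsAlternating (of : OrdSimplex X k → OrdChain X k) := by
  intro σ τ
  rw [of, of, ← map_smul, ← sub_eq_zero, ← map_sub, Submodule.mkQ_apply,
    Submodule.Quotient.mk_eq_zero]
  exact Submodule.subset_span ⟨σ, τ, rfl⟩

/-- The linear map defined by an alternating function. -/
def lift (f : OrdSimplex X k → M) (hf : IsAlternating f) : OrdChain X k →ₗ[ℤ] M :=
  (ordRelations X k).liftQ (Finsupp.linearCombination ℤ f) (by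
    rw [ordRelations, Submodule.span_le]
    rintro _ ⟨σ, τ, rfl⟩
    simp [hf σ τ])

@[simp] lemma lift_of (f : OrdSimplex X k → M) (hf : IsAlternating f) (σ : OrdSimplex X k) :
    lift f hf (of σ) = f σ := by
  simp [lift, of]

lemma hom_ext {f g : OrdChain X k →ₗ[ℤ] M} (h : ∀ σ, f (of σ) = g (of σ)) : f = g :=
  Submodule.linearMap_qext _ (Finsupp.lhom_ext' fun σ => LinearMap.ext_ring (h σ))

lemma alternating_hom (f : OrdChain X k →ₗ[ℤ] M) : IsAlternating fun σ => f (of σ) := by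
  intro σ τ
  simp only
  rw [of_alternating σ τ, map_smul]

/-- The boundary operator on oriented chains. -/
def bd : OrdChain X (k + 1) →ₗ[ℤ] OrdChain X k := lift _ of_alternating.coboundary

@[simp] lemma bd_of (σ : OrdSimplex X (k + 1)) :
    bd (of σ) = ∑ i : Fin (k + 2), (-1 : ℤ) ^ (i : ℕ) • of (σ.face i) :=
  lift_of _ _ _

/-- The augmentation. -/
def aug : OrdChain X 0 →ₗ[ℤ] ℤ := lift (fun _ => 1) fun σ τ => by
  simp [Subsingleton.elim (α := Equiv.Perm (Fin 1)) τ 1]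

@[simp] lemma aug_of (σ : OrdSimplex X 0) : aug (of σ) = 1 := lift_of _ _ _

/-! ### Comparison with chains of sequences -/

open Classical in
/-- The oriented chain of a tuple of vertices, zero if it is not an ordered simplex. -/
def ofTuple (v : Fin (k + 1) → V) : OrdChain X k :=
  if h : Function.Injective v ∧ Finset.univ.image v ∈ X.faces then of (.mk v h) else 0

lemma ofTuple_coe (σ : OrdSimplex X k) : ofTuple σ.1 = of σ := dif_pos σ.2

lemma ofTuple_of_not_injective {v : Fin (k + 1) → V} (h : ¬ Function.Injective v) :
    (ofTuple v : OrdChain X k) = 0 := dif_neg fun h' => h h'.1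

lemma ofTuple_comp (v : Fin (k + 1) → V) (τ : Equiv.Perm (Fin (k + 1))) :
    (ofTuple (v ∘ τ) : OrdChain X k) = (Equiv.Perm.sign τ : ℤ) • ofTuple v := by
  by_cases h : Function.Injective v ∧ Finset.univ.image v ∈ X.faces
  · calc (ofTuple (v ∘ τ) : OrdChain X k)
        = of ((OrdSimplex.mk v h).reorder τ) :=
          dif_pos ((OrdSimplex.mk v h).reorder τ).2
      _ = _ := by rw [of_alternating, ofTuple, dif_pos h]
  · have h' : ¬ (Function.Injective (v ∘ τ) ∧ Finset.univ.image (v ∘ τ) ∈ X.faces) := by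
      intro h''
      have this : Function.Injective (fun i => (v ∘ τ) (τ⁻¹ i)) ∧
          Finset.univ.image (fun i => (v ∘ τ) (τ⁻¹ i)) ∈ X.faces :=
        ((OrdSimplex.mk (v ∘ τ) h'').reorder τ⁻¹).2
      have e : (fun i => (v ∘ τ) (τ⁻¹ i)) = v := by
        funext i
        simp
      rw [e] at this
      exact h this
    rw [ofTuple, dif_neg h', ofTuple, dif_neg h, smul_zero]

/-- If v a = v b, every face keeping both positions is degenerate. The two faces omitting a or b
agree up to a permutation, with opposite total signs. -/
lemma sum_ofTuple_eq_zero {v : Fin (k + 2) → V} (h : ¬ Function.Injective v) :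
    ∑ i : Fin (k + 2), (-1 : ℤ) ^ (i : ℕ) • (ofTuple (v ∘ i.succAbove) : OrdChain X k) = 0 := by
  simp only [Function.Injective, not_forall] at h
  obtain ⟨a, b, hab, hne⟩ := h
  have hswap : v ∘ Equiv.swap a b = v := by
    funext x
    by_cases hxa : x = a
    · subst hxa; simp [hab]
    · by_cases hxb : x = b
      · subst hxb; simp [hab]
      · simp [Equiv.swap_apply_of_ne_of_ne hxa hxb]
  have hzero : ∀ i, i ≠ a ∧ i ≠ b →
      (-1 : ℤ) ^ (i : ℕ) • (ofTuple (v ∘ i.succAbove) : OrdChain X k) = 0 := by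
    rintro i ⟨hia, hib⟩
    rw [ofTuple_of_not_injective, smul_zero]
    obtain ⟨a', ha'⟩ := Fin.exists_succAbove_eq (Ne.symm hia)
    obtain ⟨b', hb'⟩ := Fin.exists_succAbove_eq (Ne.symm hib)
    intro hinj
    have : a' = b' := hinj (by simp [ha', hb', hab])
    exact hne (by rw [← ha', ← hb', this])
  rw [Fintype.sum_eq_add a b hne hzero]
  obtain ⟨τ', hτ', hsign⟩ := exists_perm_succAbove (Equiv.swap a b) a
  have hcomp : v ∘ a.succAbove = (v ∘ b.succAbove) ∘ τ' := by
    conv_lhs => rw [← hswap]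
    funext j
    simpa using congrArg v (hτ' j)
  rw [hcomp, ofTuple_comp, hsign, smul_smul, ← add_smul]
  have : ((-1 : ℤ) ^ (a : ℕ)) * (-1) ^ (a : ℕ) = 1 := by
    rw [← mul_pow]
    simp
  simp only [Equiv.swap_apply_left, Equiv.Perm.sign_swap hne, Units.val_neg, Units.val_one]
  convert zero_smul ℤ _
  linear_combination (-(-1) ^ (b : ℕ)) * this

open ListChain in
lemma bdList_ofFn {A : Type*} {n : ℕ} (v : Fin (n + 1) → A) :
    bdList (List.ofFn v) = ∑ i : Fin (n + 1),
      (-1 : ℤ) ^ (i : ℕ) • Finsupp.single (List.ofFn (v ∘ i.succAbove)) (1 : ℤ) := by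
  induction n with
  | zero => simp [bdList]
  | succ n ih =>
    rw [List.ofFn_succ, bdList, ih, map_sum]
    conv_rhs => rw [Fin.sum_univ_succ]
    have h0 : v ∘ (0 : Fin (n + 2)).succAbove = fun i => v i.succ := rfl
    simp only [h0, Fin.val_zero, pow_zero, one_smul, sub_eq_add_neg, ← Finset.sum_neg_distrib]
    congr 1
    refine Finset.sum_congr rfl fun i _ => ?_
    have h1 : List.ofFn (v ∘ i.succ.succAbove) =
        v 0 :: List.ofFn ((fun i => v i.succ) ∘ i.succAbove) := by
      rw [List.ofFn_succ]
      simp [Function.comp_def]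
    rw [h1, map_smul, cone_single, Fin.val_succ, pow_succ]
    simp

variable (X k) in
/-- The projection from chains of sequences to oriented chains. -/
def proj : ListChain V →ₗ[ℤ] OrdChain X k := Finsupp.linearCombination ℤ fun l =>
  open Classical in if h : ∃ v : Fin (k + 1) → V, List.ofFn v = l then ofTuple h.choose else 0

lemma proj_ofFn (v : Fin (k + 1) → V) :
    proj X k (Finsupp.single (List.ofFn v) 1) = ofTuple v := by
  have h : ∃ w : Fin (k + 1) → V, List.ofFn w = List.ofFn v := ⟨v, rfl⟩
  simp only [proj, Finsupp.linearCombination_single, one_smul, dif_pos h]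
  rw [List.ofFn_injective h.choose_spec]

lemma proj_of_length_ne {l : List V} (h : l.length ≠ k + 1) :
    proj X k (Finsupp.single l 1) = 0 := by
  have h' : ¬ ∃ v : Fin (k + 1) → V, List.ofFn v = l := by
    rintro ⟨v, rfl⟩
    simp at h
  simp [proj, dif_neg h']

open ListChain in
-- The restriction to `faceLists` matters: a tuple that spans no simplex projects to 0, although its
-- faces may be simplices.
lemma proj_bd {z : ListChain V} (hz : z ∈ supp (faceLists X)) :
    proj X k (ListChain.bd z) = bd (proj X (k + 1) z) := by
  refine ListChain.hom_congr (f := proj X k ∘ₗ ListChain.bd) (g := bd ∘ₗ proj X (k + 1))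
    (fun l hl => ?_) hz
  simp only [LinearMap.comp_apply, bd_single]
  by_cases hlen : l.length = k + 2
  · obtain ⟨v, rfl⟩ : ∃ v : Fin (k + 2) → V, List.ofFn v = l := by
      exact ⟨fun i => l.get (i.cast hlen.symm), by
        rw [← List.ofFn_congr hlen]
        simp⟩
    rw [bdList_ofFn, map_sum, proj_ofFn]
    simp only [map_smul, proj_ofFn]
    by_cases hv : Function.Injective v
    · have hface : Finset.univ.image v ∈ X.faces := by
        obtain ⟨s, hs, hvs⟩ := hl
        refine (X.isRelLowerSet_faces hs).2 (fun x hx => ?_) (by simp)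
        obtain ⟨i, -, rfl⟩ := Finset.mem_image.1 hx
        exact hvs _ (by rw [List.mem_ofFn]; exact ⟨i, rfl⟩)
      have e : (ofTuple v : OrdChain X (k + 1)) = of (.mk v ⟨hv, hface⟩) := dif_pos ⟨hv, hface⟩
      rw [e, bd_of]
      refine Finset.sum_congr rfl fun i _ => ?_
      rw [← ofTuple_coe]
      rfl
    · rw [ofTuple_of_not_injective hv, map_zero, sum_ofTuple_eq_zero hv]
  · rw [proj_of_length_ne hlen, map_zero]
    have := hom_mem (proj X k) ⊥ (fun l' hl' => ?_) (bdList_mem l)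
    · simpa using this
    · rw [Submodule.mem_bot]
      exact proj_of_length_ne (by have := hl'.2; omega)

/-! ### Oriented chains as a direct summand of chains of sequences -/

section Sorting

variable [LinearOrder V]

/-- The section of `proj` sorting the vertices of a simplex. -/
def sort : OrdChain X k →ₗ[ℤ] ListChain V :=
  lift (fun σ => (Equiv.Perm.sign (Tuple.sort σ.1) : ℤ) •
    Finsupp.single (List.ofFn (σ.1 ∘ Tuple.sort σ.1)) 1) fun σ τ => by
      have h1 : (σ.reorder τ).1 ∘ Tuple.sort (σ.reorder τ).1 = σ.1 ∘ Tuple.sort σ.1 :=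
        Tuple.comp_perm_comp_sort_eq_comp_sort (f := σ.1) (σ := τ)
      have h2 : τ * Tuple.sort (σ.reorder τ).1 = Tuple.sort σ.1 :=
        Equiv.ext fun i => σ.2.1 (congrFun h1 i)
      simp only
      rw [h1, ← h2, smul_smul, map_mul]
      congr 1
      rw [Units.val_mul, ← mul_assoc, ← Units.val_mul, Int.units_mul_self, Units.val_one, one_mul]

lemma sort_of (σ : OrdSimplex X k) : sort (of σ) = (Equiv.Perm.sign (Tuple.sort σ.1) : ℤ) •
    Finsupp.single (List.ofFn (σ.1 ∘ Tuple.sort σ.1)) 1 := lift_of _ _ _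

lemma sort_of_strictMono {σ : OrdSimplex X k} (h : StrictMono σ.1) :
    sort (of σ) = Finsupp.single (List.ofFn σ.1) 1 := by
  simp [sort_of, Tuple.sort_eq_refl_iff_monotone.2 h.monotone]

lemma hom_ext_of_strictMono {f g : OrdChain X k →ₗ[ℤ] M}
    (h : ∀ σ : OrdSimplex X k, StrictMono σ.1 → f (of σ) = g (of σ)) : f = g := by
  refine hom_ext fun σ => ?_
  have hs : StrictMono (σ.reorder (Tuple.sort σ.1)).1 :=
    (Tuple.monotone_sort σ.1).strictMono_of_injective (σ.2.1.comp (Equiv.injective _))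
  have := h _ hs
  have hf := alternating_hom f σ (Tuple.sort σ.1)
  have hg := alternating_hom g σ (Tuple.sort σ.1)
  simp only at hf hg
  rw [hf, hg] at this
  have := congrArg (fun x => (Equiv.Perm.sign (Tuple.sort σ.1) : ℤ) • x) this
  simpa only [smul_smul, ← Units.val_mul, Int.units_mul_self, Units.val_one, one_smul] using this

lemma proj_sort (z : OrdChain X k) : proj X k (sort z) = z := by
  have : proj X k ∘ₗ sort = LinearMap.id := hom_ext_of_strictMono fun σ hσ => by
    rw [LinearMap.comp_apply, sort_of_strictMono hσ, proj_ofFn, ofTuple_coe, LinearMap.id_apply]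
  exact LinearMap.congr_fun this z

/-- Faces of a sorted simplex are sorted, so no signs appear on generators. -/
lemma bd_sort (z : OrdChain X (k + 1)) : ListChain.bd (sort z) = sort (bd z) := by
  have : ListChain.bd ∘ₗ sort (X := X) (k := k + 1) = sort ∘ₗ bd := hom_ext_of_strictMono fun σ hσ => by
    have hface : ∀ i, StrictMono (σ.face i).1 := fun i => hσ.comp (Fin.strictMono_succAbove i)
    simp only [LinearMap.comp_apply, sort_of_strictMono hσ, ListChain.bd_single, bdList_ofFn,
      bd_of, map_sum, map_smul, sort_of_strictMono (hface _)]
    rfl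
  exact LinearMap.congr_fun this z

lemma bd_sort_zero (z : OrdChain X 0) :
    ListChain.bd (sort z) = Finsupp.single [] (aug z) := by
  have : ListChain.bd ∘ₗ sort (X := X) (k := 0) = Finsupp.lsingle [] ∘ₗ aug := hom_ext_of_strictMono fun σ hσ => by
    simp [sort_of_strictMono hσ, ListChain.bd_single, ListChain.bdList]
  exact LinearMap.congr_fun this z

lemma sort_mem (z : OrdChain X k) : sort z ∈ ListChain.supp (faceLists X) := by
  obtain ⟨w, rfl⟩ := (ordRelations X k).mkQ_surjective z
  have : ∀ w : OrdSimplex X k →₀ ℤ, sort ((ordRelations X k).mkQ w) =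
      Finsupp.linearCombination ℤ (fun σ => sort (of σ)) w := fun w =>
    LinearMap.congr_fun (f := sort ∘ₗ (ordRelations X k).mkQ)
      (Finsupp.lhom_ext' fun σ => LinearMap.ext_ring (by simp [of])) w
  rw [this]
  refine Submodule.sum_mem _ fun σ _ => Submodule.smul_mem _ _ ?_
  change sort (of σ) ∈ _
  rw [sort_of]
  refine Submodule.smul_mem _ _ (ListChain.single_mem_supp (S := faceLists X)
    ⟨σ.verts, σ.2.2, fun v hv => ?_⟩ 1)
  rw [List.mem_ofFn] at hv
  obtain ⟨i, rfl⟩ := hv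
  exact Finset.mem_image_of_mem _ (Finset.mem_univ _)

end Sorting

/-- Exactness passes to a retract: fill the sorted cycle by vertex sequences and project back. -/
theorem exists_bd_eq [ContractibleSpace (Realization X)] {z : OrdChain X (k + 1)}
    (hz : bd z = 0) : ∃ y : OrdChain X (k + 2), bd y = z := by
  classical
  let _ : LinearOrder V := linearOrderOfSTO WellOrderingRel
  obtain ⟨y, hy, hyz⟩ := exists_bd_of_contractible (sort_mem z) (by rw [bd_sort, hz, map_zero])
  exact ⟨proj X (k + 2) y, by rw [← proj_bd hy, hyz, proj_sort]⟩

theorem exists_bd_eq_zero [ContractibleSpace (Realization X)] {z : OrdChain X 0}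
    (hz : aug z = 0) : ∃ y : OrdChain X 1, bd y = z := by
  classical
  let _ : LinearOrder V := linearOrderOfSTO WellOrderingRel
  obtain ⟨y, hy, hyz⟩ := exists_bd_of_contractible (sort_mem z)
    (by rw [bd_sort_zero, hz, Finsupp.single_zero])
  exact ⟨proj X 1 y, by rw [← proj_bd hy, hyz, proj_sort]⟩

lemma bd_bd (z : OrdChain X (k + 2)) : bd (bd z) = 0 := by
  classical
  let _ : LinearOrder V := linearOrderOfSTO WellOrderingRel
  rw [← proj_sort (bd (bd z)), ← bd_sort, ← bd_sort, ListChain.bd_bd, map_zero]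

lemma aug_bd (z : OrdChain X 1) : aug (bd z) = 0 := by
  classical
  let _ : LinearOrder V := linearOrderOfSTO WellOrderingRel
  have := bd_sort_zero (bd z)
  rw [← bd_sort, ListChain.bd_bd] at this
  simpa using this.symm

end OrdChain

end OrdChain

end HigherKazhdan

end

noncomputable section

namespace HigherKazhdan

/-! ### Projective dimension and splittings of a resolution -/

section Abelian

open CategoryTheory CategoryTheory.Limits

universe v u

variable {C : Type u} [Category.{v} C] [Abelian C]

lemma epi_kernelLift_of_exact {S : ShortComplex C} (hS : S.Exact) :
    Epi (kernel.lift S.g S.f S.zero) :=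
  S.exact_iff_epi_kernel_lift.1 hS

/-- Dimension shift along a projective cover term; the bound is strict, so `HasProjectiveDimensionLT
_ 1` means projective. -/
lemma hasProjectiveDimensionLT_kernel_of_epi {A B : C} [Projective A] (f : A ⟶ B) [Epi f] (n : ℕ)
    (h : HasProjectiveDimensionLT B (n + 2)) : HasProjectiveDimensionLT (kernel f) (n + 1) := by
  have hS : (ShortComplex.mk (kernel.ι f) f (kernel.condition f)).ShortExact :=
    { exact := ShortComplex.exact_kernel f }
  exact (hS.hasProjectiveDimensionLT_X₃_iff n inferInstance).1 h

lemma hasProjectiveDimensionLT_kernel_of_exact {S : ShortComplex C} (hS : S.Exact)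
    [Projective S.X₁] (n : ℕ) (h : HasProjectiveDimensionLT (kernel S.g) (n + 2)) :
    HasProjectiveDimensionLT (kernel S.f) (n + 1) := by
  have := epi_kernelLift_of_exact hS
  have h' := hasProjectiveDimensionLT_kernel_of_epi (kernel.lift S.g S.f S.zero) n h
  let e : kernel (kernel.lift S.g S.f S.zero) ≅ kernel S.f :=
    (kernelCompMono (kernel.lift S.g S.f S.zero) (kernel.ι S.g)).symm ≪≫
      kernelIsoOfEq (kernel.lift_ι _ _ _)
  exact hasProjectiveDimensionLT_of_iso e (n + 1)

/-- By exactness X₁ maps onto the projective object ker g. The endomorphism e is this epimorphism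
followed by a section of it. -/
lemma exists_retraction_of_exact {S : ShortComplex C} (hS : S.Exact)
    [Projective (kernel S.g)] : ∃ e : S.X₁ ⟶ S.X₁, e ≫ S.f = S.f ∧
      ∀ ⦃A : C⦄ (h : A ⟶ S.X₁), h ≫ S.f = 0 → h ≫ e = 0 := by
  have := epi_kernelLift_of_exact hS
  let l := kernel.lift S.g S.f S.zero
  have hl : l ≫ kernel.ι S.g = S.f := kernel.lift_ι _ _ _
  refine ⟨l ≫ Projective.factorThru (𝟙 _) l, ?_, fun A h h0 => ?_⟩
  · rw [← hl, Category.assoc, Projective.factorThru_comp_assoc, Category.id_comp]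
  · have : h ≫ l = 0 := by
      rw [← cancel_mono (kernel.ι S.g), Category.assoc, hl, h0, zero_comp]
    rw [← Category.assoc, this, zero_comp]

/-- This kernel is the (j + 2)-nd syzygy of Z, and each syzygy lowers the bound by one. -/
lemma hasProjectiveDimensionLT_kernel_d {Z : C} (P : ProjectiveResolution Z) (j n : ℕ)
    (h : HasProjectiveDimensionLT Z (n + j + 3)) :
    HasProjectiveDimensionLT (kernel (P.complex.d (j + 1) j)) (n + 1) := by
  induction j generalizing n with
  | zero =>
    have h0 := hasProjectiveDimensionLT_kernel_of_epi (P.π.f 0) (n + 1) h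
    exact hasProjectiveDimensionLT_kernel_of_exact P.exact₀ n h0
  | succ j ih =>
    have := ih (n + 1) (by convert h using 1; omega)
    exact hasProjectiveDimensionLT_kernel_of_exact (P.exact_succ j) n this

/-- If `Z` has projective dimension at most `m + 1`, then the kernel of the boundary operator of a
projective resolution in degree `m + 1` is a direct summand. -/
lemma exists_retraction_of_hasProjectiveDimensionLT {Z : C} (P : ProjectiveResolution Z) (m : ℕ)
    (h : HasProjectiveDimensionLT Z (m + 2)) :
    ∃ e : P.complex.X (m + 1) ⟶ P.complex.X (m + 1),
      e ≫ P.complex.d (m + 1) m = P.complex.d (m + 1) m ∧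
        P.complex.d (m + 2) (m + 1) ≫ e = 0 := by
  -- The (m + 1)-st syzygy is projective. It is the kernel of the augmentation for m = 0, and the
  -- kernel of the preceding boundary operator otherwise.
  rcases m with _ | m
  · have h0 := hasProjectiveDimensionLT_kernel_of_epi (P.π.f 0) 0 h
    have : Projective (kernel (P.π.f 0)) := projective_iff_hasProjectiveDimensionLT_one.2 h0
    obtain ⟨e, he, he'⟩ := exists_retraction_of_exact P.exact₀
    exact ⟨e, he, he' _ (P.complex.d_comp_d _ _ _)⟩
  · have h0 := hasProjectiveDimensionLT_kernel_d P m 0 (by convert h using 1; omega)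
    have : Projective (kernel (P.complex.d (m + 1) m)) :=
      projective_iff_hasProjectiveDimensionLT_one.2 h0
    obtain ⟨e, he, he'⟩ := exists_retraction_of_exact (P.exact_succ m)
    exact ⟨e, he, he' _ (P.complex.d_comp_d _ _ _)⟩

end Abelian

/-! ### Fundamental domains and normal forms of ordered simplices -/

section NormalForm

variable {V : Type} [DecidableEq V] {X : AbstractSimplicialComplex V}
  {Γ : Type} [Group Γ] [MulAction Γ V] [IsSimplicialAction X Γ] {k : ℕ}

lemma OrdSimplex.verts_smul (g : Γ) (σ : OrdSimplex X k) : (g • σ).verts = g • σ.verts := by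
  ext v
  simp only [OrdSimplex.verts, Finset.mem_image, Finset.mem_smul_finset, Finset.mem_univ, true_and]
  constructor
  · rintro ⟨i, rfl⟩
    exact ⟨σ.1 i, ⟨i, rfl⟩, rfl⟩
  · rintro ⟨_, ⟨i, rfl⟩, rfl⟩
    exact ⟨i, rfl⟩

lemma OrdSimplex.verts_reorder (σ : OrdSimplex X k) (τ : Equiv.Perm (Fin (k + 1))) :
    (σ.reorder τ).verts = σ.verts := by
  ext v
  simp only [OrdSimplex.verts, Finset.mem_image, Finset.mem_univ, true_and]
  constructor
  · rintro ⟨i, rfl⟩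
    exact ⟨τ i, rfl⟩
  · rintro ⟨i, rfl⟩
    exact ⟨τ.symm i, congrArg σ.1 (τ.apply_symm_apply i)⟩

lemma OrdSimplex.mul_smul' (g h : Γ) (σ : OrdSimplex X k) : (g * h) • σ = g • h • σ :=
  OrdSimplex.ext fun i => mul_smul g h (σ.1 i)

lemma OrdSimplex.one_smul' (σ : OrdSimplex X k) : (1 : Γ) • σ = σ :=
  OrdSimplex.ext fun i => one_smul Γ (σ.1 i)

variable (F : FundamentalDomain X Γ)

namespace FundamentalDomain

lemma toDomain_spec (σ : OrdSimplex X k) : (F.toDomain σ • σ).verts ∈ F.carrier := by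
  rw [OrdSimplex.verts_smul]
  exact (F.existsUnique σ.verts σ.2.2).choose_spec.1

lemma toDomain_eq {σ : OrdSimplex X k} {g : Γ} (h : (g • σ).verts ∈ F.carrier) :
    F.toDomain σ = g := by
  rw [OrdSimplex.verts_smul] at h
  exact ((F.existsUnique σ.verts σ.2.2).choose_spec.2 g h).symm

lemma toDomain_smul (g : Γ) (σ : OrdSimplex X k) : F.toDomain (g • σ) = F.toDomain σ * g⁻¹ := by
  refine F.toDomain_eq ?_
  rw [← OrdSimplex.mul_smul', inv_mul_cancel_right]
  exact F.toDomain_spec σ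

lemma toDomain_reorder (σ : OrdSimplex X k) (τ : Equiv.Perm (Fin (k + 1))) :
    F.toDomain (σ.reorder τ) = F.toDomain σ := by
  refine F.toDomain_eq ?_
  change ((F.toDomain σ • σ).reorder τ).verts ∈ _
  rw [OrdSimplex.verts_reorder]
  exact F.toDomain_spec σ

lemma toDomain_eq_one {σ : OrdSimplex X k} (h : σ.verts ∈ F.carrier) : F.toDomain σ = 1 :=
  F.toDomain_eq (by rwa [OrdSimplex.one_smul'])

lemma smul_toDomain (g : Γ) (σ : OrdSimplex X k) :
    F.toDomain (g • σ) • g • σ = F.toDomain σ • σ := by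
  rw [toDomain_smul, ← OrdSimplex.mul_smul', inv_mul_cancel_right]

lemma toDomain_reorder_smul (σ : OrdSimplex X k) (τ : Equiv.Perm (Fin (k + 1))) :
    F.toDomain (σ.reorder τ) • σ.reorder τ = (F.toDomain σ • σ).reorder τ := by
  rw [toDomain_reorder]
  rfl

variable [LinearOrder V]

variable (k) in
/-- The sorted ordered simplices of the fundamental domain. -/
def Base : Type := {σ : OrdSimplex X k // σ.verts ∈ F.carrier ∧ StrictMono σ.1}

/-- The permutation sorting the translate of `σ` in the fundamental domain. -/
def sorting (σ : OrdSimplex X k) : Equiv.Perm (Fin (k + 1)) := Tuple.sort (F.toDomain σ • σ).1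

/-- The representative of `σ` modulo translation and reordering. -/
def base (σ : OrdSimplex X k) : F.Base k :=
  ⟨(F.toDomain σ • σ).reorder (F.sorting σ), by
    rw [OrdSimplex.verts_reorder]
    exact F.toDomain_spec σ,
    (Tuple.monotone_sort _).strictMono_of_injective
      ((F.toDomain σ • σ).2.1.comp (Equiv.injective _))⟩

lemma sorting_smul (g : Γ) (σ : OrdSimplex X k) : F.sorting (g • σ) = F.sorting σ := by
  rw [sorting, smul_toDomain, sorting]

lemma base_smul (g : Γ) (σ : OrdSimplex X k) : F.base (g • σ) = F.base σ :=
  Subtype.ext (by simp only [base, sorting_smul, smul_toDomain])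

lemma base_reorder (σ : OrdSimplex X k) (τ : Equiv.Perm (Fin (k + 1))) :
    F.base (σ.reorder τ) = F.base σ := by
  refine Subtype.ext (OrdSimplex.ext fun i => ?_)
  simp only [base, sorting, toDomain_reorder_smul]
  exact congrFun (Tuple.comp_perm_comp_sort_eq_comp_sort (f := (F.toDomain σ • σ).1) (σ := τ)) i

lemma mul_sorting_reorder (σ : OrdSimplex X k) (τ : Equiv.Perm (Fin (k + 1))) :
    τ * F.sorting (σ.reorder τ) = F.sorting σ := by
  refine Equiv.ext fun i => (F.toDomain σ • σ).2.1 ?_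
  rw [sorting, toDomain_reorder_smul]
  exact congrFun (Tuple.comp_perm_comp_sort_eq_comp_sort (f := (F.toDomain σ • σ).1) (σ := τ)) i

lemma sign_sorting_reorder (σ : OrdSimplex X k) (τ : Equiv.Perm (Fin (k + 1))) :
    (Equiv.Perm.sign (F.sorting (σ.reorder τ)) : ℤ) =
      (Equiv.Perm.sign τ : ℤ) * Equiv.Perm.sign (F.sorting σ) := by
  rw [← F.mul_sorting_reorder σ τ, map_mul, Units.val_mul, ← mul_assoc, ← Units.val_mul,
    Int.units_mul_self, Units.val_one, one_mul]

lemma sorting_coe (b : F.Base k) : F.sorting b.1 = 1 := by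
  rw [sorting, F.toDomain_eq_one b.2.1, OrdSimplex.one_smul']
  exact Tuple.sort_eq_refl_iff_monotone.2 b.2.2.monotone

lemma base_coe (b : F.Base k) : F.base b.1 = b := by
  refine Subtype.ext ?_
  simp only [base, sorting_coe, F.toDomain_eq_one b.2.1, OrdSimplex.one_smul']
  rfl

end FundamentalDomain

/-- Equivariant functions on ordered simplices. -/
def IsEquivariant {A : Type*} [AddCommGroup A] (ρ : Representation ℤ Γ A)
    (f : OrdSimplex X k → A) : Prop := ∀ g σ, f (g • σ) = ρ g (f σ)

namespace FundamentalDomain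

variable [LinearOrder V] {A : Type*} [AddCommGroup A] (ρ : Representation ℤ Γ A)

/-- The equivariant alternating function with prescribed values on sorted simplices of the
fundamental domain. -/
def extend (c : F.Base k → A) (σ : OrdSimplex X k) : A :=
  (Equiv.Perm.sign (F.sorting σ) : ℤ) • ρ (F.toDomain σ)⁻¹ (c (F.base σ))

lemma isAlternating_extend (c : F.Base k → A) : IsAlternating (F.extend ρ c) := fun σ τ => by
  rw [extend, extend, toDomain_reorder, base_reorder, sign_sorting_reorder, mul_smul]

lemma isEquivariant_extend (c : F.Base k → A) : IsEquivariant ρ (F.extend ρ c) := fun g σ => by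
  rw [extend, extend, toDomain_smul, base_smul, sorting_smul, mul_inv_rev, inv_inv, map_mul,
    map_smul]
  rfl

lemma extend_eq {f : OrdSimplex X k → A} (hf : IsAlternating f) (hf' : IsEquivariant ρ f)
    (σ : OrdSimplex X k) : F.extend ρ (fun b => f b.1) σ = f σ := by
  rw [extend]
  simp only [base]
  rw [hf, map_smul, smul_smul, ← Units.val_mul, Int.units_mul_self, Units.val_one, one_smul, hf',
    ← Module.End.mul_apply, ← map_mul, inv_mul_cancel, map_one, Module.End.one_apply]

end FundamentalDomain

end NormalForm

end HigherKazhdan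

end

noncomputable section

namespace HigherKazhdan

/-! ### The simplicial resolution -/

section Resolution

open CategoryTheory

variable {V : Type} [DecidableEq V] (X : AbstractSimplicialComplex V)
  (Γ : Type) [Group Γ] [MulAction Γ V] [IsSimplicialAction X Γ] (k : ℕ)

lemma isAlternating_of_smul {X : AbstractSimplicialComplex V} {Γ : Type} [Group Γ] [MulAction Γ V]
    [IsSimplicialAction X Γ] {k : ℕ} {M : Type*} [AddCommGroup M] {f : OrdSimplex X k → M}
    (hf : IsAlternating f) (g : Γ) : IsAlternating fun σ => f (g • σ) :=
  fun σ τ => hf (g • σ) τ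

variable {X Γ k} in
/-- Translation of oriented chains. -/
def ordSmul (g : Γ) : OrdChain X k →ₗ[ℤ] OrdChain X k :=
  OrdChain.lift (fun σ => OrdChain.of (g • σ)) (isAlternating_of_smul OrdChain.of_alternating g)

variable {X Γ k} in
lemma ordSmul_of (g : Γ) (σ : OrdSimplex X k) :
    ordSmul g (OrdChain.of σ) = OrdChain.of (g • σ) :=
  OrdChain.lift_of _ _ _

/-- The action of the group on oriented chains. -/
def ordRepresentation : Representation ℤ Γ (OrdChain X k) where
  toFun := ordSmul
  map_one' := OrdChain.hom_ext fun σ => by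
    rw [ordSmul_of, OrdSimplex.one_smul']
    rfl
  map_mul' g h := OrdChain.hom_ext fun σ => by
    rw [Module.End.mul_apply, ordSmul_of, ordSmul_of, ordSmul_of, OrdSimplex.mul_smul']

variable {k} in
@[simp] lemma ordRepresentation_of (g : Γ) (σ : OrdSimplex X k) :
    ordRepresentation X Γ k g (OrdChain.of σ) = OrdChain.of (g • σ) :=
  ordSmul_of g σ

/-- Oriented chains as a representation. -/
abbrev ordRep : Rep ℤ Γ := Rep.of (ordRepresentation X Γ k)

/-- The boundary operator as a morphism of representations. -/
def ordBd : ordRep X Γ (k + 1) ⟶ ordRep X Γ k := Rep.ofHom ⟨OrdChain.bd, fun g =>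
  OrdChain.hom_ext fun σ => by
    simp only [LinearMap.comp_apply, ordRepresentation_of, OrdChain.bd_of, map_sum, map_smul]
    rfl⟩

/-- The augmentation as a morphism of representations. -/
def ordAug : ordRep X Γ 0 ⟶ Rep.trivial ℤ Γ ℤ := Rep.ofHom ⟨OrdChain.aug, fun g =>
  OrdChain.hom_ext fun σ => by simp⟩

lemma ordBd_comp : ordBd X Γ (k + 1) ≫ ordBd X Γ k = 0 := by
  refine Rep.hom_ext (Representation.IntertwiningMap.toLinearMap_injective _ _
    (LinearMap.ext fun x => ?_))
  exact OrdChain.bd_bd x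

lemma ordBd_comp_aug : ordBd X Γ 0 ≫ ordAug X Γ = 0 := by
  refine Rep.hom_ext (Representation.IntertwiningMap.toLinearMap_injective _ _
    (LinearMap.ext fun x => ?_))
  exact OrdChain.aug_bd x

/-- The simplicial chain complex in the category of representations. -/
def ordComplex : ChainComplex (Rep ℤ Γ) ℕ :=
  ChainComplex.of (fun k => ordRep X Γ k) (fun k => ordBd X Γ k) fun k => ordBd_comp X Γ k

lemma ordComplex_d : (ordComplex X Γ).d (k + 1) k = ordBd X Γ k := by
  simp [ordComplex]

lemma rep_exact_iff {R G : Type} [CommRing R] [Group G] (S : ShortComplex (Rep R G)) :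
    S.Exact ↔ ∀ x : S.X₂, S.g.hom x = 0 → ∃ y : S.X₁, S.f.hom y = x := by
  rw [← S.exact_map_iff_of_faithful (forget₂ (Rep R G) (ModuleCat R)),
    ShortComplex.moduleCat_exact_iff]
  rfl

variable {X Γ k}

/-- An equivariant map on chains is freely determined by its values on the sorted simplices of F.
Those values are lifted through the epimorphism and extended. -/
lemma projective_ordRep (F : FundamentalDomain X Γ) : Projective (ordRep X Γ k) where
  factors {E Z} f e he := by
    obtain @⟨E, hE₁, hE₂, ρE⟩ := E
    obtain @⟨Z, hZ₁, hZ₂, ρZ⟩ := Z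
    -- The ℤ-module structures carried by the objects are replaced by the canonical ones, which
    -- `extend` uses.
    obtain rfl : hE₂ = AddCommGroup.toIntModule E := Subsingleton.elim _ _
    obtain rfl : hZ₂ = AddCommGroup.toIntModule Z := Subsingleton.elim _ _
    let _ : LinearOrder V := by
      classical
      exact linearOrderOfSTO WellOrderingRel
    have hsurj := (Rep.epi_iff_surjective e).1 he
    choose l hl using hsurj
    let c : F.Base k → E := fun b => l (f.hom (OrdChain.of b.1))
    have hfa : IsAlternating fun σ : OrdSimplex X k => f.hom (OrdChain.of σ) :=
      OrdChain.alternating_hom f.hom.toLinearMap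
    have hfe : IsEquivariant ρZ fun σ : OrdSimplex X k => f.hom (OrdChain.of σ) := fun g σ => by
      have := Rep.hom_comm_apply f g (OrdChain.of σ)
      rw [← this]
      simp
    refine ⟨Rep.ofHom (ρ := ordRepresentation X Γ k) (σ := ρE)
      ⟨OrdChain.lift _ (F.isAlternating_extend ρE c), fun g => OrdChain.hom_ext fun σ => ?_⟩, ?_⟩
    · simp only [LinearMap.comp_apply, ordRepresentation_of, OrdChain.lift_of]
      exact F.isEquivariant_extend ρE c g σ
    · refine Rep.hom_ext (Representation.IntertwiningMap.toLinearMap_injective _ _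
        (OrdChain.hom_ext fun σ => ?_))
      change e.hom (OrdChain.lift _ (F.isAlternating_extend ρE c) (OrdChain.of σ)) = _
      rw [OrdChain.lift_of]
      refine Eq.trans ?_ (F.extend_eq ρZ hfa hfe σ)
      rw [FundamentalDomain.extend, FundamentalDomain.extend, map_zsmul, Rep.hom_comm_apply, hl]

/-- The simplicial chain complex of a contractible complex with a free action is a projective
resolution. -/
def ordResolution [ContractibleSpace (Realization X)] (F : FundamentalDomain X Γ) :
    ProjectiveResolution (Rep.trivial ℤ Γ ℤ) where
  complex := ordComplex X Γ
  projective k := projective_ordRep F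
  π := (ChainComplex.toSingle₀Equiv _ _).symm ⟨ordAug X Γ, by
    rw [ordComplex_d]
    exact ordBd_comp_aug X Γ⟩
  quasiIso := ⟨fun n => by
    rcases n with _ | n
    · rw [ChainComplex.quasiIsoAt₀_iff, ShortComplex.quasiIso_iff_of_zeros']
      · refine (ShortComplex.exact_and_epi_g_iff_of_iso (S₂ := ShortComplex.mk (ordBd X Γ 0)
          (ordAug X Γ) (ordBd_comp_aug X Γ)) ?_).2 ⟨?_, ?_⟩
        · exact ShortComplex.isoMk (Iso.refl _) (Iso.refl _) (Iso.refl _)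
            (by erw [Category.id_comp])
            (by erw [Category.id_comp])
        · rw [rep_exact_iff]
          exact fun x hx => OrdChain.exists_bd_eq_zero hx
        -- A contractible space is nonempty, so X has a vertex, and its multiples reach all of ℤ.
        · refine (Rep.epi_iff_surjective _).2 fun c => ?_
          obtain ⟨s, hs, -⟩ := (Classical.arbitrary (Realization X)).2
          obtain ⟨v, hv⟩ := (X.isRelLowerSet_faces hs).1
          have hface : Finset.univ.image (fun _ : Fin 1 => v) ∈ X.faces :=
            (X.isRelLowerSet_faces hs).2 (by simpa using hv) (by simp)
          let σ : OrdSimplex X 0 :=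
            OrdSimplex.mk (fun _ => v) ⟨fun i j _ => Fin.ext (by omega), hface⟩
          refine ⟨(c : ℤ) • OrdChain.of σ, ?_⟩
          rw [map_smul]
          change c • OrdChain.aug (OrdChain.of σ) = c
          rw [OrdChain.aug_of]
          exact mul_one (c : ℤ)
      all_goals rfl
    · rw [quasiIsoAt_iff_exactAt']
      · rw [HomologicalComplex.exactAt_iff' _ (n + 1 + 1) (n + 1) n (by simp) (by simp),
          rep_exact_iff]
        intro x hx
        change ((ordComplex X Γ).d (n + 1) n).hom x = 0 at hx
        rw [ordComplex_d] at hx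
        obtain ⟨y, hy⟩ := OrdChain.exists_bd_eq hx
        refine ⟨y, ?_⟩
        change ((ordComplex X Γ).d (n + 2) (n + 1)).hom y = x
        rw [ordComplex_d]
        exact hy
      · apply ChainComplex.exactAt_succ_single_obj⟩

/-- Group cohomology vanishes iff every simplicial cocycle is a coboundary. -/
theorem subsingleton_groupCohomology_iff [ContractibleSpace (Realization X)]
    (F : FundamentalDomain X Γ) (M : Rep.{0} ℤ Γ) (m : ℕ) :
    Subsingleton (groupCohomology M (m + 1)) ↔
      ∀ f : ordRep X Γ (m + 1) ⟶ M, ordBd X Γ (m + 1) ≫ f = 0 →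
        ∃ g : ordRep X Γ m ⟶ M, ordBd X Γ m ≫ g = f := by
  rw [← ModuleCat.isZero_iff_subsingleton,
    (groupCohomologyIso M (m + 1) (ordResolution F)).isZero_iff,
    ← HomologicalComplex.exactAt_iff_isZero_homology,
    HomologicalComplex.exactAt_iff' _ m (m + 1) (m + 2) (by simp) (by simp),
    ShortComplex.moduleCat_exact_iff]
  have hd : ∀ j, (ordResolution F).complex.d (j + 1) j = ordBd X Γ j := ordComplex_d X Γ
  refine ⟨fun h f hf => ?_, fun h x hx => ?_⟩
  · obtain ⟨g, hg⟩ := h f (by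
      change (ordResolution F).complex.d (m + 2) (m + 1) ≫ f = 0
      rwa [hd])
    change (ordResolution F).complex.d (m + 1) m ≫ g = f at hg
    exact ⟨g, by rwa [hd] at hg⟩
  · change (ordResolution F).complex.d (m + 2) (m + 1) ≫ x = 0 at hx
    rw [hd] at hx
    obtain ⟨g, hg⟩ := h x hx
    refine ⟨g, ?_⟩
    change (ordResolution F).complex.d (m + 1) m ≫ g = x
    rwa [hd]

/-- In cohomological dimension at most `m + 1`, the cocycles of degree `m + 1` are the image of an
idempotent induced by an endomorphism of the chain module. -/
theorem exists_retraction_ordRep [ContractibleSpace (Realization X)]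
    (F : FundamentalDomain X Γ) (m : ℕ)
    (h : cohomologicalDimension Γ ≤ ((m + 1 : ℕ) : WithBot ℕ∞)) :
    ∃ e : ordRep X Γ (m + 1) ⟶ ordRep X Γ (m + 1),
      e ≫ ordBd X Γ m = ordBd X Γ m ∧ ordBd X Γ (m + 1) ≫ e = 0 := by
  have h' := (projectiveDimension_le_iff _ _).1 h
  have hd : ∀ j, (ordResolution F).complex.d (j + 1) j = ordBd X Γ j := ordComplex_d X Γ
  obtain ⟨e, he, he'⟩ := exists_retraction_of_hasProjectiveDimensionLT (ordResolution F) m h'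
  rw [hd] at he he'
  exact ⟨e, he, he'⟩

end Resolution

end HigherKazhdan

end

noncomputable section

namespace HigherKazhdan

/-! ### Coordinates for equivariant cochains -/

section Coordinates

variable {V : Type} [DecidableEq V] {X : AbstractSimplicialComplex V}
  {Γ : Type} [Group Γ] [MulAction Γ V] [IsSimplicialAction X Γ] {k l j : ℕ}

lemma OrdChain.induction_on {P : OrdChain X k → Prop} (x : OrdChain X k) (h0 : P 0)
    (hadd : ∀ x y, P x → P y → P (x + y)) (hsmul : ∀ (a : ℤ) σ, P (a • OrdChain.of σ)) : P x := by
  obtain ⟨y, rfl⟩ := (ordRelations X k).mkQ_surjective x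
  induction y using Finsupp.induction_linear with
  | zero => rwa [map_zero]
  | add y z hy hz =>
    rw [map_add]
    exact hadd _ _ hy hz
  | single σ a =>
    rw [← mul_one a, ← smul_eq_mul, ← Finsupp.smul_single, map_smul]
    exact hsmul a σ

/-- Linear maps between chain groups which commute with translations. -/
def CommutesWithTranslations (Γ : Type) [Group Γ] [MulAction Γ V] [IsSimplicialAction X Γ]
    (a : OrdChain X l →ₗ[ℤ] OrdChain X k) : Prop :=
  ∀ (g : Γ) x, a (ordRepresentation X Γ l g x) = ordRepresentation X Γ k g (a x)

lemma commutesWithTranslations_hom (e : ordRep X Γ l ⟶ ordRep X Γ k) :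
    CommutesWithTranslations Γ (e.hom.toLinearMap : OrdChain X l →ₗ[ℤ] OrdChain X k) :=
  fun g x => Rep.hom_comm_apply e g x

lemma commutesWithTranslations_bd :
    CommutesWithTranslations Γ (OrdChain.bd : OrdChain X (k + 1) →ₗ[ℤ] OrdChain X k) :=
  commutesWithTranslations_hom (ordBd X Γ k)

namespace FundamentalDomain

variable (F : FundamentalDomain X Γ) [LinearOrder V] {A : Type} [AddCommGroup A]
  (ρ : Representation ℤ Γ A)

/-- The equivariant homomorphism on chains with prescribed values on sorted simplices of the
fundamental domain. -/
def ev (c : F.Base k → A) : OrdChain X k →ₗ[ℤ] A :=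
  OrdChain.lift (F.extend ρ c) (F.isAlternating_extend ρ c)

lemma ev_of (c : F.Base k → A) (σ : OrdSimplex X k) :
    F.ev ρ c (OrdChain.of σ) = F.extend ρ c σ := OrdChain.lift_of _ _ _

lemma ev_smul (c : F.Base k → A) (g : Γ) (x : OrdChain X k) :
    F.ev ρ c (ordRepresentation X Γ k g x) = ρ g (F.ev ρ c x) := by
  refine LinearMap.congr_fun (f := F.ev ρ c ∘ₗ ordRepresentation X Γ k g)
    (g := ρ g ∘ₗ F.ev ρ c) (OrdChain.hom_ext fun σ => ?_) x
  simp only [LinearMap.comp_apply, ordRepresentation_of, ev_of]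
  exact F.isEquivariant_extend ρ c g σ

lemma ev_eq {f : OrdChain X k →ₗ[ℤ] A}
    (hf : ∀ g x, f (ordRepresentation X Γ k g x) = ρ g (f x)) :
    F.ev ρ (fun b => f (OrdChain.of b.1)) = f := OrdChain.hom_ext fun σ => by
  rw [ev_of]
  exact F.extend_eq ρ (OrdChain.alternating_hom f)
    (fun g σ => by rw [← hf, ordRepresentation_of]) σ

/-- The operator on equivariant cochains, in coordinates, dual to an operator on chains. -/
def op (a : OrdChain X l →ₗ[ℤ] OrdChain X k) (c : F.Base k → A) : F.Base l → A :=
  fun b => F.ev ρ c (a (OrdChain.of b.1))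

lemma ev_op {a : OrdChain X l →ₗ[ℤ] OrdChain X k} (ha : CommutesWithTranslations Γ a)
    (c : F.Base k → A) (x : OrdChain X l) : F.ev ρ (F.op ρ a c) x = F.ev ρ c (a x) :=
  LinearMap.congr_fun (F.ev_eq ρ (f := F.ev ρ c ∘ₗ a) fun g x => by
    rw [LinearMap.comp_apply, ha, ev_smul, LinearMap.comp_apply]) x

lemma op_op {a : OrdChain X l →ₗ[ℤ] OrdChain X k} (ha : CommutesWithTranslations Γ a)
    (b : OrdChain X j →ₗ[ℤ] OrdChain X l) (c : F.Base k → A) :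
    F.op ρ b (F.op ρ a c) = F.op ρ (a ∘ₗ b) c :=
  funext fun _ => F.ev_op ρ ha c _

open CategoryTheory in
/-- The morphism of representations corresponding to an equivariant cochain in coordinates. -/
def evHom (c : F.Base k → A) : ordRep X Γ k ⟶ Rep.of ρ :=
  Rep.ofHom ⟨F.ev ρ c, fun g => LinearMap.ext fun x => F.ev_smul ρ c g x⟩

open CategoryTheory in
lemma ev_hom (f : ordRep X Γ k ⟶ Rep.of ρ) (x : OrdChain X k) :
    F.ev ρ (fun b => f.hom (OrdChain.of b.1)) x = f.hom x :=
  LinearMap.congr_fun (F.ev_eq ρ (f := f.hom.toLinearMap) fun g x => Rep.hom_comm_apply f g x) x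

open CategoryTheory in
/-- Vanishing of cohomology in coordinates: the image of a retraction onto the cocycles is contained
in the image of the coboundary operator. -/
lemma subsingleton_groupCohomology_iff_op [ContractibleSpace (Realization X)] {m : ℕ}
    {e : ordRep X Γ (m + 1) ⟶ ordRep X Γ (m + 1)} (he : e ≫ ordBd X Γ m = ordBd X Γ m)
    (he' : ordBd X Γ (m + 1) ≫ e = 0) :
    Subsingleton (groupCohomology (Rep.of ρ) (m + 1)) ↔
      ∀ c : F.Base (m + 1) → A, ∃ c', F.op ρ OrdChain.bd c' = F.op ρ e.hom.toLinearMap c := by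
  have hbe : ∀ x : OrdChain X (m + 1), OrdChain.bd (e.hom x : OrdChain X (m + 1)) =
      OrdChain.bd x := fun x => congrArg (fun f => f.hom x) he
  have heb : ∀ x : OrdChain X (m + 2), e.hom (OrdChain.bd x) = 0 :=
    fun x => congrArg (fun f => f.hom x) he'
  rw [subsingleton_groupCohomology_iff F]
  refine ⟨fun h c => ?_, fun h f hf => ?_⟩
  -- Everything in the range of the dual of e is a cocycle, because e∂ = 0.
  · obtain ⟨g, hg⟩ := h (F.evHom ρ (F.op ρ e.hom.toLinearMap c)) (by
      refine Rep.hom_ext (Representation.IntertwiningMap.toLinearMap_injective _ _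
        (LinearMap.ext fun x => ?_))
      refine (F.ev_op ρ (commutesWithTranslations_hom e) c (OrdChain.bd x)).trans ?_
      refine (congrArg (F.ev ρ c) (heb x)).trans (map_zero _))
    refine ⟨fun b => g.hom (OrdChain.of b.1), funext fun b => ?_⟩
    refine (F.ev_hom ρ g _).trans ?_
    refine (congrArg (fun f => f.hom (OrdChain.of b.1)) hg).trans ?_
    exact F.ev_op ρ (commutesWithTranslations_hom e) c (OrdChain.of b.1)
  · obtain ⟨c', hc'⟩ := h fun b => f.hom (OrdChain.of b.1)
    refine ⟨F.evHom ρ c', Rep.hom_ext (Representation.IntertwiningMap.toLinearMap_injective _ _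
      (LinearMap.ext fun x => ?_))⟩
    refine (F.ev_op ρ commutesWithTranslations_bd c' x).symm.trans ?_
    rw [hc', F.ev_op ρ (commutesWithTranslations_hom e)]
    refine (F.ev_hom ρ f _).trans ?_
    -- Conversely x - e x is a cycle, hence a boundary, and a cocycle does not distinguish x from e
    -- x.
    obtain ⟨y, hy⟩ := OrdChain.exists_bd_eq (z := x - e.hom x) (by
      rw [map_sub, sub_eq_zero]
      exact (hbe x).symm)
    have h0 : f.hom (x - e.hom x) = 0 := by
      rw [← hy]
      exact congrArg (fun f => f.hom y) hf
    rw [map_sub, sub_eq_zero] at h0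
    exact h0.symm

end FundamentalDomain

end Coordinates

end HigherKazhdan

end

noncomputable section

namespace HigherKazhdan

/-! ### Perturbation of surjectivity onto the range of an idempotent -/

section Perturbation

variable {E G : Type*} [NormedAddCommGroup E] [NormedSpace ℂ E] [CompleteSpace E]
  [NormedAddCommGroup G] [NormedSpace ℂ G] [CompleteSpace G]

/-- If `D` maps onto the range of `e`, with control of preimages, then so do small perturbations
`D'` and `e'` of `D` and `e`. -/
lemma exists_apply_eq_of_perturbation {D D' : E →L[ℂ] G} {e e' : G →L[ℂ] G} {C ε : ℝ}
    (hD : ∀ z, ∃ x, D x = e z ∧ ‖x‖ ≤ C * ‖z‖) (hC : 1 ≤ C)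
    (he : ∀ z, e' (e' z) = e' z) (heD : ∀ x, e' (D' x) = D' x)
    (hDε : ‖D' - D‖ ≤ ε) (heε : ‖e' - e‖ ≤ ε) (hε : 2 * ε < C⁻¹) (z : G) :
    ∃ x, D' x = e' z := by
  choose r hr hr' using hD
  -- As z = e z + (z - e z), the map (x, w) ↦ D x + (w - e w) is onto, with right inverse z ↦ (r z,
  -- z). That r need not be linear is harmless.
  let Φ : E × G →L[ℂ] G := D.coprod (ContinuousLinearMap.id ℂ G - e)
  let Φ' : E × G →L[ℂ] G := D'.coprod (ContinuousLinearMap.id ℂ G - e')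
  have hε0 : 0 ≤ ε := (norm_nonneg _).trans hDε
  have hC0 : 0 ≤ C := zero_le_one.trans hC
  let R : Φ.NonlinearRightInverse :=
    { toFun := fun z => (r z, z)
      nnnorm := ⟨C, hC0⟩
      bound' := fun z => by
        refine max_le (hr' z) ?_
        exact le_mul_of_one_le_left (norm_nonneg z) hC
      right_inv' := fun z => by
        simp [Φ, hr] }
  have hΦ : ApproximatesLinearOn Φ' Φ Set.univ ⟨2 * ε, by positivity⟩ := by
    refine LipschitzOnWith.approximatesLinearOn ?_
    refine LipschitzWith.lipschitzOnWith ?_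
    refine (AddMonoidHomClass.lipschitz_of_bound (Φ' - Φ) (2 * ε) fun w => ?_).weaken ?_
    · have h1 : (Φ' - Φ) w = (D' - D) w.1 - (e' - e) w.2 := by
        simp [Φ, Φ']
        abel
      rw [h1]
      calc ‖(D' - D) w.1 - (e' - e) w.2‖ ≤ ‖(D' - D) w.1‖ + ‖(e' - e) w.2‖ := norm_sub_le _ _
        _ ≤ ε * ‖w‖ + ε * ‖w‖ := by
          gcongr
          · exact ((D' - D).le_opNorm _).trans (by gcongr; exact norm_fst_le w)
          · exact ((e' - e).le_opNorm _).trans (by gcongr; exact norm_snd_le w)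
        _ = 2 * ε * ‖w‖ := by ring
    · exact (Real.toNNReal_of_nonneg (by positivity)).le
  have hpos : 0 < C⁻¹ - 2 * ε := sub_pos.2 hε
  -- The radius is chosen so that the image covers the ball of radius ‖z‖ about 0.
  have hball := hΦ.surjOn_closedBall_of_nonlinearRightInverse R
    (b := 0) (ε := ‖z‖ / (C⁻¹ - 2 * ε)) (by positivity) (Set.subset_univ _)
  obtain ⟨w, -, hw⟩ := hball (show z ∈ _ by
    rw [map_zero, mem_closedBall_zero_iff]
    change ‖z‖ ≤ (C⁻¹ - 2 * ε) * (‖z‖ / (C⁻¹ - 2 * ε))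
    rw [mul_div_cancel₀ _ hpos.ne'])
  refine ⟨w.1, ?_⟩
  have hw' : D' w.1 + (w.2 - e' w.2) = z := hw
  -- Applying e' kills the component w.2 - e' w.2 and fixes D' w.1.
  rw [← hw', map_add, map_sub, he, heD, sub_self, add_zero]

end Perturbation

lemma norm_sign_smul {G : Type*} [SeminormedAddCommGroup G] {n : ℕ} (τ : Equiv.Perm (Fin n))
    (v : G) : ‖(Equiv.Perm.sign τ : ℤ) • v‖ = ‖v‖ := by
  rcases Int.units_eq_one_or (Equiv.Perm.sign τ) with h | h <;> simp [h]

/-! ### Dependence of operators on the unitary representation -/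

section Lipschitz

variable {Γ : Type} [Group Γ] {H : Type} [NormedAddCommGroup H] [InnerProductSpace ℂ H]
  [CompleteSpace H]

lemma norm_unitary_apply (u : unitary (H →L[ℂ] H)) (v : H) : ‖(u : H →L[ℂ] H) v‖ = ‖v‖ :=
  ContinuousLinearMap.norm_map_of_mem_unitary u.2 v

lemma norm_unitary_le (u : unitary (H →L[ℂ] H)) : ‖(u : H →L[ℂ] H)‖ ≤ 1 :=
  ContinuousLinearMap.opNorm_le_bound _ zero_le_one fun v => by
    rw [norm_unitary_apply, one_mul]

lemma norm_inv_sub_inv (u v : unitary (H →L[ℂ] H)) :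
    ‖((u⁻¹ : unitary (H →L[ℂ] H)) : H →L[ℂ] H) - (v⁻¹ : unitary (H →L[ℂ] H))‖ =
      ‖(u : H →L[ℂ] H) - v‖ := by
  change ‖star (u : H →L[ℂ] H) - star (v : H →L[ℂ] H)‖ = _
  rw [← star_sub, norm_star]

/-- Evaluation at a group element is Lipschitz in the representation. -/
lemma exists_norm_sub_le_dist {S : Finset Γ} (hS : Subgroup.closure (S : Set Γ) = ⊤) (g : Γ) :
    ∃ L : ℝ, 0 ≤ L ∧ ∀ π ρ : Γ →* unitary (H →L[ℂ] H),
      ‖(π g : H →L[ℂ] H) - ρ g‖ ≤ L * dist (α := HomU H S) π ρ := by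
  have hg : g ∈ Subgroup.closure (S : Set Γ) := hS ▸ Subgroup.mem_top g
  induction hg using Subgroup.closure_induction with
  | mem s hs =>
    refine ⟨1, zero_le_one, fun π ρ => ?_⟩
    rw [one_mul, HomU.dist_eq]
    exact le_ciSup (f := fun s : S => ‖(π s : H →L[ℂ] H) - ρ s‖)
      (Set.finite_range _).bddAbove ⟨s, hs⟩
  | one => exact ⟨0, le_rfl, fun π ρ => by simp⟩
  | mul g h _ _ ihg ihh =>
    obtain ⟨L, hL, hL'⟩ := ihg
    obtain ⟨M, hM, hM'⟩ := ihh
    refine ⟨L + M, add_nonneg hL hM, fun π ρ => ?_⟩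
    have key : (π (g * h) : H →L[ℂ] H) - ρ (g * h) =
        ((π g : H →L[ℂ] H) - ρ g) * (π h : H →L[ℂ] H) +
          (ρ g : H →L[ℂ] H) * ((π h : H →L[ℂ] H) - ρ h) := by
      rw [map_mul, map_mul, Submonoid.coe_mul, Submonoid.coe_mul]
      noncomm_ring
    rw [key, add_mul]
    refine (norm_add_le _ _).trans (add_le_add ?_ ?_)
    · exact (norm_mul_le _ _).trans <|
        (mul_le_of_le_one_right (norm_nonneg _) (norm_unitary_le _)).trans (hL' π ρ)
    · exact (norm_mul_le _ _).trans <|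
        (mul_le_of_le_one_left (norm_nonneg _) (norm_unitary_le _)).trans (hM' π ρ)
  | inv g _ ih =>
    obtain ⟨L, hL, hL'⟩ := ih
    refine ⟨L, hL, fun π ρ => ?_⟩
    rw [map_inv, map_inv, norm_inv_sub_inv]
    exact hL' π ρ

variable {V : Type} [DecidableEq V] {X : AbstractSimplicialComplex V} [MulAction Γ V]
  [IsSimplicialAction X Γ] {k l : ℕ}

namespace FundamentalDomain

variable (F : FundamentalDomain X Γ) [LinearOrder V]

/-- A fixed chain involves finitely many group elements, so K depends on x but not on the
representations. -/
lemma exists_norm_ev_le [Fintype (F.Base k)] {S : Finset Γ}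
    (hS : Subgroup.closure (S : Set Γ) = ⊤) (x : OrdChain X k) :
    ∃ K : ℝ, 0 ≤ K ∧ ∀ (π ρ : Γ →* unitary (H →L[ℂ] H)) (c : F.Base k → H),
      ‖F.ev (toRepresentation π) c x‖ ≤ K * ‖c‖ ∧
      ‖F.ev (toRepresentation π) c x - F.ev (toRepresentation ρ) c x‖ ≤
        K * dist (α := HomU H S) π ρ * ‖c‖ := by
  induction x using OrdChain.induction_on with
  | h0 => exact ⟨0, le_rfl, fun π ρ c => by simp⟩
  | hadd x y hx hy =>
    obtain ⟨K, hK, hK'⟩ := hx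
    obtain ⟨M, hM, hM'⟩ := hy
    refine ⟨K + M, add_nonneg hK hM, fun π ρ c => ⟨?_, ?_⟩⟩
    · rw [map_add, add_mul]
      exact (norm_add_le _ _).trans (add_le_add (hK' π ρ c).1 (hM' π ρ c).1)
    · rw [map_add, map_add, add_sub_add_comm, add_mul, add_mul]
      exact (norm_add_le _ _).trans (add_le_add (hK' π ρ c).2 (hM' π ρ c).2)
  | hsmul a σ =>
    obtain ⟨L, hL, hL'⟩ := exists_norm_sub_le_dist (H := H) hS (F.toDomain σ)⁻¹
    -- The 1 serves the norm bound (unitaries are isometric), the L the Lipschitz bound.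
    refine ⟨‖a‖ * (1 + L), by positivity, fun π ρ c => ⟨?_, ?_⟩⟩
    · rw [map_smul, ev_of, extend]
      refine (norm_zsmul_le _ _).trans ?_
      rw [norm_sign_smul, mul_assoc]
      gcongr
      refine (norm_unitary_apply _ _).le.trans ((norm_le_pi_norm c _).trans ?_)
      exact le_mul_of_one_le_left (norm_nonneg _) (by linarith)
    · rw [map_smul, map_smul, ← smul_sub, ev_of, ev_of, extend, extend, ← smul_sub]
      refine (norm_zsmul_le _ _).trans ?_
      rw [norm_sign_smul, mul_assoc, mul_assoc]
      gcongr
      change ‖((π (F.toDomain σ)⁻¹ : H →L[ℂ] H) - ρ (F.toDomain σ)⁻¹) (c (F.base σ))‖ ≤ _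
      refine (ContinuousLinearMap.le_opNorm _ _).trans ?_
      rw [← mul_assoc]
      refine mul_le_mul ((hL' π ρ).trans ?_) (norm_le_pi_norm c _) (norm_nonneg _)
        (mul_nonneg (by linarith) dist_nonneg)
      exact mul_le_mul_of_nonneg_right (by linarith) dist_nonneg

lemma extend_add {A : Type} [AddCommGroup A] (ρ : Representation ℤ Γ A) (c c' : F.Base k → A)
    (σ : OrdSimplex X k) : F.extend ρ (c + c') σ = F.extend ρ c σ + F.extend ρ c' σ := by
  simp [extend, smul_add]

lemma ev_add {A : Type} [AddCommGroup A] (ρ : Representation ℤ Γ A) (c c' : F.Base k → A) :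
    F.ev ρ (c + c') = F.ev ρ c + F.ev ρ c' := OrdChain.hom_ext fun σ => by
  simp only [LinearMap.add_apply, ev_of, extend_add]

lemma ev_complex_smul (π : Γ →* unitary (H →L[ℂ] H)) (a : ℂ) (c : F.Base k → H)
    (x : OrdChain X k) :
    F.ev (toRepresentation π) (a • c) x = a • F.ev (toRepresentation π) c x := by
  induction x using OrdChain.induction_on with
  | h0 => simp
  | hadd x y hx hy => rw [map_add, map_add, hx, hy, smul_add]
  | hsmul i σ =>
    rw [map_smul, map_smul, ev_of, ev_of, extend, extend, Pi.smul_apply, smul_comm a, smul_comm a]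
    congr 2
    exact map_smul (π (F.toDomain σ)⁻¹ : H →L[ℂ] H) a _

/-- The operator on equivariant cochains as a continuous linear map. -/
def opCLM [Fintype (F.Base k)] [Fintype (F.Base l)] {S : Finset Γ}
    (hS : Subgroup.closure (S : Set Γ) = ⊤) (π : Γ →* unitary (H →L[ℂ] H))
    (a : OrdChain X l →ₗ[ℤ] OrdChain X k) : (F.Base k → H) →L[ℂ] (F.Base l → H) :=
  ContinuousLinearMap.pi fun b => LinearMap.mkContinuousOfExistsBound
    { toFun := fun c => F.ev (toRepresentation π) c (a (OrdChain.of b.1))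
      map_add' := fun c c' => by rw [ev_add, LinearMap.add_apply]
      map_smul' := fun z c => F.ev_complex_smul π z c _ }
    ((F.exists_norm_ev_le hS _).imp fun _ hK c => (hK.2 π π c).1)

lemma opCLM_apply [Fintype (F.Base k)] [Fintype (F.Base l)] {S : Finset Γ}
    (hS : Subgroup.closure (S : Set Γ) = ⊤) (π : Γ →* unitary (H →L[ℂ] H))
    (a : OrdChain X l →ₗ[ℤ] OrdChain X k) (c : F.Base k → H) :
    F.opCLM hS π a c = F.op (toRepresentation π) a c := rfl

lemma exists_norm_opCLM_le [Fintype (F.Base k)] [Fintype (F.Base l)] {S : Finset Γ}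
    (hS : Subgroup.closure (S : Set Γ) = ⊤) (a : OrdChain X l →ₗ[ℤ] OrdChain X k) :
    ∃ K : ℝ, 0 ≤ K ∧ ∀ π ρ : Γ →* unitary (H →L[ℂ] H), ‖F.opCLM hS π a‖ ≤ K ∧
      ‖F.opCLM hS π a - F.opCLM hS ρ a‖ ≤ K * dist (α := HomU H S) π ρ := by
  choose K hK hK' using fun b : F.Base l =>
    F.exists_norm_ev_le (H := H) hS (a (OrdChain.of b.1))
  have hle : ∀ b, K b ≤ ∑ b, K b := fun b =>
    Finset.single_le_sum (fun b _ => hK b) (Finset.mem_univ b)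
  refine ⟨∑ b, K b, Finset.sum_nonneg fun b _ => hK b, fun π ρ => ⟨?_, ?_⟩⟩
  · refine ContinuousLinearMap.opNorm_le_bound _ (Finset.sum_nonneg fun b _ => hK b) fun c => ?_
    refine (pi_norm_le_iff_of_nonneg (mul_nonneg (Finset.sum_nonneg fun b _ => hK b)
      (norm_nonneg _))).2 fun b => ((hK' b π ρ c).1).trans ?_
    gcongr
    exact hle b
  · have h0 : 0 ≤ (∑ b, K b) * dist (α := HomU H S) π ρ :=
      mul_nonneg (Finset.sum_nonneg fun b _ => hK b) dist_nonneg
    refine ContinuousLinearMap.opNorm_le_bound _ h0 fun c => ?_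
    refine (pi_norm_le_iff_of_nonneg (mul_nonneg h0 (norm_nonneg _))).2 fun b =>
      ((hK' b π ρ c).2).trans ?_
    exact mul_le_mul_of_nonneg_right (mul_le_mul_of_nonneg_right (hle b) dist_nonneg)
      (norm_nonneg _)

end FundamentalDomain

end Lipschitz

end HigherKazhdan

end

noncomputable section

namespace HigherKazhdan

/-! ### Untwisted cochains and their norms -/

section Norms

variable {V : Type} [DecidableEq V] {X : AbstractSimplicialComplex V}
  {Γ : Type} [Group Γ] [MulAction Γ V] [IsSimplicialAction X Γ] {k : ℕ}
  (F : FundamentalDomain X Γ)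
  {H : Type} [NormedAddCommGroup H]

namespace FundamentalDomain

/-- A fundamental domain has finitely many simplices in dimensions where there are finitely many
orbits. -/
lemma finite_carrier {n : ℕ} (hX : IsTypeFModel X Γ n) (hk : k ≤ n) :
    Finite {σ : OrdSimplex X k // σ.verts ∈ F.carrier} := by
  obtain ⟨T, hT, hT'⟩ := hX.finite_skeleton
  have hfin : {s | s ∈ F.carrier ∧ ∃ σ : OrdSimplex X k, σ.verts = s}.Finite := by
    choose g hg using fun s : {s | s ∈ F.carrier ∧ ∃ σ : OrdSimplex X k, σ.verts = s} =>
      hT' s.1 (F.subset_faces s.2.1) (by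
        obtain ⟨σ, hσ⟩ := s.2.2
        rw [← hσ]
        exact Finset.card_image_le.trans (by simpa using hk))
    have := hT.to_subtype
    refine Set.finite_coe_iff.1 (Finite.of_injective (β := T) (fun s => ⟨g s • s.1, hg s⟩) ?_)
    -- Two simplices of F in one orbit coincide, by uniqueness of the translating element.
    intro s t hst
    have hst' : g s • s.1 = g t • t.1 := congrArg Subtype.val hst
    have h1 : ((g t)⁻¹ * g s) • s.1 = t.1 := by rw [mul_smul, hst', inv_smul_smul]
    have h2 : (g t)⁻¹ * g s = 1 := (F.existsUnique s.1 (F.subset_faces s.2.1)).unique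
      (by rw [h1]; exact t.2.1) (by rw [one_smul]; exact s.2.1)
    rw [h2, one_smul] at h1
    exact Subtype.ext h1
  have hU : (⋃ s ∈ {s | s ∈ F.carrier ∧ ∃ σ : OrdSimplex X k, σ.verts = s},
      (s : Set V)).Finite := hfin.biUnion fun s _ => s.finite_toSet
  have := hU.to_subtype
  refine Finite.of_injective (β := Fin (k + 1) → ⋃ s ∈ {s | s ∈ F.carrier ∧
    ∃ σ : OrdSimplex X k, σ.verts = s}, (s : Set V)) (fun σ i => ⟨σ.1.1 i, ?_⟩) ?_
  · exact Set.mem_biUnion (x := σ.1.verts) ⟨σ.2, σ.1, rfl⟩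
      (Finset.mem_image_of_mem _ (Finset.mem_univ i))
  · exact fun σ τ h => Subtype.ext (OrdSimplex.ext fun i => congrArg Subtype.val (congrFun h i))

variable [LinearOrder V]

lemma finite_base {n : ℕ} (hX : IsTypeFModel X Γ n) (hk : k ≤ n) : Finite (F.Base k) :=
  have := F.finite_carrier hX hk
  Finite.of_injective (β := {σ : OrdSimplex X k // σ.verts ∈ F.carrier})
    (fun b => ⟨b.1, b.2.1⟩) fun _ _ h => Subtype.ext (congrArg (fun σ => σ.1) h)

/-- The invariant alternating function with prescribed values on sorted simplices of the fundamental
domain. -/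
def untwisted (c : F.Base k → H) (σ : OrdSimplex X k) : H :=
  (Equiv.Perm.sign (F.sorting σ) : ℤ) • c (F.base σ)

lemma untwisted_coe (c : F.Base k → H) (b : F.Base k) : F.untwisted c b.1 = c b := by
  rw [untwisted, sorting_coe, base_coe]
  simp

lemma untwisted_injective : Function.Injective (F.untwisted : (F.Base k → H) → _) :=
  fun c c' h => funext fun b => by rw [← F.untwisted_coe c, h, untwisted_coe]

lemma untwisted_zero : F.untwisted (0 : F.Base k → H) = 0 := funext fun _ => smul_zero _

lemma untwisted_add (c c' : F.Base k → H) :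
    F.untwisted (c + c') = F.untwisted c + F.untwisted c' := funext fun _ => smul_add _ _ _

lemma norm_untwisted (c : F.Base k → H) (σ : OrdSimplex X k) :
    ‖F.untwisted c σ‖ = ‖c (F.base σ)‖ := norm_sign_smul _ _

lemma untwisted_eq {p : ℝ} {f : OrdSimplex X k → H} (hf : IsCochain F p f) :
    F.untwisted (fun b => f b.1) = f := funext fun σ => by
  rw [untwisted]
  simp only [base]
  rw [hf.alternating, smul_smul, ← Units.val_mul, Int.units_mul_self, Units.val_one, one_smul,
    hf.invariant]

/-- With `exists_mul_enorm_le`, this makes the p-norm equivalent to the sup norm in coordinates: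
here each of the finitely many terms is bounded by the largest, there a largest term alone is kept.
-/
lemma cochainNorm_untwisted_le [Fintype (F.Base k)]
    [Fintype {σ : OrdSimplex X k // σ.verts ∈ F.carrier}] {p : ℝ} (hp : 1 ≤ p) :
    ∃ A : ℝ≥0∞, A ≠ ∞ ∧ ∀ c : F.Base k → H, cochainNorm F p (F.untwisted c) ≤ A * ‖c‖ₑ := by
  have hp0 : 0 < p := zero_lt_one.trans_le hp
  refine ⟨(((k + 1)! : ℝ≥0∞)⁻¹ *
    (Fintype.card {σ : OrdSimplex X k // σ.verts ∈ F.carrier} : ℝ≥0∞)) ^ (1 / p), ?_, fun c => ?_⟩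
  · refine ENNReal.rpow_ne_top_of_nonneg (by positivity) (ENNReal.mul_ne_top ?_ (by simp))
    exact ENNReal.inv_ne_top.2 (by exact_mod_cast (Nat.factorial_pos _).ne')
  · have h1 : ‖c‖ₑ = (‖c‖ₑ ^ p) ^ (1 / p) := by
      rw [← ENNReal.rpow_mul, mul_one_div_cancel hp0.ne', ENNReal.rpow_one]
    rw [h1, ← ENNReal.mul_rpow_of_nonneg _ _ (by positivity), cochainNorm, mul_assoc]
    gcongr
    rw [tsum_fintype, ← nsmul_eq_mul, ← Finset.card_univ]
    refine Finset.sum_le_card_nsmul _ _ _ fun σ _ => ?_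
    gcongr
    rw [enorm_le_iff_norm_le, norm_untwisted]
    exact norm_le_pi_norm c _

lemma exists_mul_enorm_le [Fintype (F.Base k)] {p : ℝ} (hp : 1 ≤ p) :
    ∃ B : ℝ≥0∞, B ≠ 0 ∧ ∀ c : F.Base k → H, B * ‖c‖ₑ ≤ cochainNorm F p (F.untwisted c) := by
  have hp0 : 0 < p := zero_lt_one.trans_le hp
  refine ⟨(((k + 1)! : ℝ≥0∞)⁻¹) ^ (1 / p), ?_, fun c => ?_⟩
  · have : (((k + 1)! : ℝ≥0∞)⁻¹) ≠ 0 := ENNReal.inv_ne_zero.2 (by simp)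
    simp [this, hp0.le]
  · rcases isEmpty_or_nonempty (F.Base k) with h | h
    · have : c = 0 := Subsingleton.elim _ _
      simp [this]
    · obtain ⟨b, hb⟩ := Finite.exists_max fun b => ‖c b‖
      have h1 : ‖c‖ₑ ≤ (‖F.untwisted c b.1‖ₑ ^ p) ^ (1 / p) := by
        rw [← ENNReal.rpow_mul, mul_one_div_cancel hp0.ne', ENNReal.rpow_one, untwisted_coe,
          enorm_le_iff_norm_le]
        exact (pi_norm_le_iff_of_nonneg (norm_nonneg _)).2 hb
      refine (mul_le_mul_right h1 _).trans ?_
      rw [← ENNReal.mul_rpow_of_nonneg _ _ (by positivity), cochainNorm]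
      gcongr
      exact ENNReal.le_tsum (f := fun σ : {σ : OrdSimplex X k // σ.verts ∈ F.carrier} =>
        ‖F.untwisted c σ.1‖ₑ ^ p) ⟨b.1, b.2.1⟩

lemma isCochain_untwisted [Fintype (F.Base k)]
    [Fintype {σ : OrdSimplex X k // σ.verts ∈ F.carrier}] {p : ℝ} (hp : 1 ≤ p)
    (c : F.Base k → H) : IsCochain F p (F.untwisted c) where
  alternating σ τ := by rw [untwisted, untwisted, base_reorder, sign_sorting_reorder, mul_smul]
  invariant σ := by rw [untwisted, untwisted, base_smul, sorting_smul]
  integrable := by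
    obtain ⟨A, hA, hA'⟩ := F.cochainNorm_untwisted_le (H := H) (k := k) hp
    exact (hA' c).trans_lt (ENNReal.mul_lt_top hA.lt_top enorm_lt_top)

/-! ### Kazhdan constants in coordinates and uniform openness -/

variable [InnerProductSpace ℂ H] [CompleteSpace H]

lemma extend_eq_untwisted (π : Γ →* unitary (H →L[ℂ] H)) (c : F.Base k → H) (σ : OrdSimplex X k) :
    F.extend (toRepresentation π) c σ =
      (π (F.toDomain σ)⁻¹ : H →L[ℂ] H) (F.untwisted c σ) :=
  (map_zsmul (π (F.toDomain σ)⁻¹ : H →L[ℂ] H) _ _).symm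

/-- Passing from f to the equivariant cochain σ ↦ π(γ_σ)⁻¹ f(σ) turns the twisted codifferential
into the plain simplicial coboundary. -/
lemma codiff_untwisted (π : Γ →* unitary (H →L[ℂ] H)) (c : F.Base k → H) :
    codiff F π (F.untwisted c) = F.untwisted (F.op (toRepresentation π) OrdChain.bd c) := by
  funext σ
  have h1 : F.ev (toRepresentation π) c (OrdChain.bd (OrdChain.of σ)) =
      (π (F.toDomain σ)⁻¹ : H →L[ℂ] H)
        (F.untwisted (F.op (toRepresentation π) OrdChain.bd c) σ) := by
    rw [← F.ev_op _ commutesWithTranslations_bd, ev_of, extend_eq_untwisted]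
  have h2 : ∀ v : H, (π (F.toDomain σ) : H →L[ℂ] H) ((π (F.toDomain σ)⁻¹ : H →L[ℂ] H) v) = v :=
    fun v => by
      rw [← mul_apply_eq_comp, ← Submonoid.coe_mul, ← map_mul, mul_inv_cancel, map_one,
        Submonoid.coe_one, one_apply_eq_self]
  rw [← h2 (F.untwisted _ σ), ← h1, OrdChain.bd_of, map_sum, map_sum, codiff]
  refine Finset.sum_congr rfl fun i _ => ?_
  rw [map_smul, map_zsmul, ev_of, extend_eq_untwisted, map_mul, Submonoid.coe_mul,
    mul_apply_eq_comp]

lemma op_zero {l : ℕ} (π : Γ →* unitary (H →L[ℂ] H)) (a : OrdChain X l →ₗ[ℤ] OrdChain X k) :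
    F.op (toRepresentation π) a 0 = 0 := funext fun b => by
  have h := F.ev_add (toRepresentation π) (0 : F.Base k → H) 0
  rw [add_zero, left_eq_add] at h
  rw [op, h]
  rfl

/-- A lower bound on the Kazhdan constant yields preimages of controlled norm under the coboundary
operator. -/
lemma exists_op_eq_of_lt_kazhdanConstant [Fintype (F.Base k)]
    [Fintype {σ : OrdSimplex X k // σ.verts ∈ F.carrier}] {p : ℝ} (hp : 1 ≤ p)
    {π : Γ →* unitary (H →L[ℂ] H)} {κ : ℝ≥0∞} (hκ0 : κ ≠ 0) (hκ : κ < kazhdanConstant F p k π)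
    (c : F.Base k → H) : ∃ c' : F.Base k → H,
      F.op (toRepresentation π) OrdChain.bd c' = F.op (toRepresentation π) OrdChain.bd c ∧
      κ * cochainNorm F p (F.untwisted c') ≤
        cochainNorm F p (F.untwisted (F.op (toRepresentation π) OrdChain.bd c)) := by
  -- Cocycles do not enter the infimum defining the Kazhdan constant; for them the preimage 0 works.
  by_cases hc : F.op (toRepresentation π) OrdChain.bd c = 0
  · refine ⟨0, ?_, ?_⟩
    · rw [hc, op_zero]
    · obtain ⟨A, -, hA⟩ := F.cochainNorm_untwisted_le (H := H) (k := k) hp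
      have h0 : cochainNorm F p (F.untwisted (0 : F.Base k → H)) = 0 := by
        simpa using hA 0
      rw [h0, mul_zero]
      exact zero_le
  · have hne : codiff F π (F.untwisted c) ≠ 0 := by
      rw [codiff_untwisted, ← F.untwisted_zero]
      exact fun h => hc (F.untwisted_injective h)
    have h1 := hκ.trans_le (iInf_le_of_le (F.untwisted c)
      (iInf_le_of_le (F.isCochain_untwisted hp c) (iInf_le _ hne)))
    have h2 := ENNReal.mul_lt_of_lt_div h1
    -- The infimum over kernel elements v is strictly below ‖df‖ / κ, so some f + v already
    -- satisfies the bound. Strictness of κ is what avoids attaining the infimum.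
    rw [mul_comm, ← ENNReal.lt_div_iff_mul_lt (Or.inl hκ0) (Or.inl h1.ne_top)] at h2
    simp only [iInf_lt_iff] at h2
    obtain ⟨v, hv, hv', h⟩ := h2
    rw [ENNReal.lt_div_iff_mul_lt (Or.inl hκ0) (Or.inl h1.ne_top), mul_comm, ← F.untwisted_eq hv,
      ← untwisted_add, codiff_untwisted] at h
    refine ⟨_, ?_, h.le⟩
    rw [← F.untwisted_eq hv, codiff_untwisted, ← F.untwisted_zero] at hv'
    have h0 := F.untwisted_injective hv'
    funext b
    rw [op, ev_add, LinearMap.add_apply]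
    exact (congrArg _ (congrFun h0 b)).trans (add_zero _)

/-- Uniform version of the openness of the vanishing of cohomology. -/
theorem exists_forall_cohomologyVanishes_of_dist_lt [ContractibleSpace (Realization X)] {m : ℕ}
    (hX : IsTypeFModel X Γ (m + 1))
    (hcd : cohomologicalDimension Γ ≤ ((m + 1 : ℕ) : WithBot ℕ∞))
    {S : Finset Γ} (hS : Subgroup.closure (S : Set Γ) = ⊤) {p : ℝ} (hp : 1 ≤ p)
    (hκ : 0 < ⨅ (π : Γ →* unitary (H →L[ℂ] H)) (_ : CohomologyVanishes (m + 1) π),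
      kazhdanConstant F p m π) :
    ∃ δ : ℝ, 0 < δ ∧ ∀ π ρ : Γ →* unitary (H →L[ℂ] H), CohomologyVanishes (m + 1) π →
      dist (α := HomU H S) ρ π < δ → CohomologyVanishes (m + 1) ρ := by
  have hfin := F.finite_carrier hX m.le_succ
  have hfin' := F.finite_carrier hX (le_refl (m + 1))
  have := F.finite_base hX m.le_succ
  have := F.finite_base hX (le_refl (m + 1))
  have := Fintype.ofFinite {σ : OrdSimplex X m // σ.verts ∈ F.carrier}
  have := Fintype.ofFinite {σ : OrdSimplex X (m + 1) // σ.verts ∈ F.carrier}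
  have := Fintype.ofFinite (F.Base m)
  have := Fintype.ofFinite (F.Base (m + 1))
  obtain ⟨e, he, he'⟩ := exists_retraction_ordRep F m hcd
  have hvan := fun π : Γ →* unitary (H →L[ℂ] H) =>
    F.subsingleton_groupCohomology_iff_op (toRepresentation π) he he'
  have heq := commutesWithTranslations_hom e
  set a : OrdChain X (m + 1) →ₗ[ℤ] OrdChain X (m + 1) := e.hom.toLinearMap with ha
  have hba : (OrdChain.bd : OrdChain X (m + 1) →ₗ[ℤ] _) ∘ₗ a = OrdChain.bd :=
    LinearMap.ext fun x => congrArg (fun f => f.hom x) he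
  have hab : a ∘ₗ OrdChain.bd = 0 := LinearMap.ext fun x => congrArg (fun f => f.hom x) he'
  -- The difference a x - x is a cycle, hence a boundary, and a kills boundaries.
  have haa : a ∘ₗ a = a := LinearMap.ext fun x => by
    obtain ⟨y, hy⟩ := OrdChain.exists_bd_eq (z := a x - x) (by
      rw [map_sub, sub_eq_zero]
      exact LinearMap.congr_fun hba x)
    have h0 : a (a x - x) = 0 := by
      rw [← hy]
      exact LinearMap.congr_fun hab y
    rwa [map_sub, sub_eq_zero] at h0
  obtain ⟨K, hK0, hK⟩ := F.exists_norm_opCLM_le (H := H) hS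
    (OrdChain.bd : OrdChain X (m + 1) →ₗ[ℤ] OrdChain X m)
  obtain ⟨M, hM0, hM⟩ := F.exists_norm_opCLM_le (H := H) hS a
  obtain ⟨A, hA, hA'⟩ := F.cochainNorm_untwisted_le (H := H) (k := m + 1) hp
  obtain ⟨B, hB, hB'⟩ := F.exists_mul_enorm_le (H := H) (k := m) hp
  -- One κ lies below all Kazhdan constants of representations with vanishing cohomology; the
  -- uniformity of δ originates here.
  obtain ⟨κ, hκ0, hκ'⟩ := exists_between hκ
  have hC : ∃ C : ℝ, 1 ≤ C ∧ ∀ π : Γ →* unitary (H →L[ℂ] H), CohomologyVanishes (m + 1) π →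
      ∀ z, ∃ c, F.opCLM hS π OrdChain.bd c = F.opCLM hS π a z ∧ ‖c‖ ≤ C * ‖z‖ := by
    -- The constant chains ‖c'‖ ≤ B⁻¹‖c'‖_p, the Kazhdan bound κ⁻¹, the comparison A in degree m +
    -- 1, and the norm bound M for the dual of e.
    have hD : A * ENNReal.ofReal M / (κ * B) ≠ ∞ :=
      ENNReal.div_ne_top (ENNReal.mul_ne_top hA ENNReal.ofReal_ne_top) (mul_ne_zero hκ0.ne' hB)
    refine ⟨max 1 (A * ENNReal.ofReal M / (κ * B)).toReal, le_max_left _ _, fun π hπ z => ?_⟩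
    obtain ⟨c, hc⟩ := (hvan π).1 hπ z
    obtain ⟨c', h1, h2⟩ := F.exists_op_eq_of_lt_kazhdanConstant hp hκ0.ne'
      (hκ'.trans_le (iInf₂_le π hπ)) c
    refine ⟨c', h1.trans hc, ?_⟩
    have h3 : ‖F.opCLM hS π a z‖ₑ ≤ ENNReal.ofReal M * ‖z‖ₑ := by
      rw [← ofReal_norm, ← ofReal_norm, ← ENNReal.ofReal_mul hM0]
      exact ENNReal.ofReal_le_ofReal ((F.opCLM hS π a).le_of_opNorm_le (hM π π).1 z)
    have h4 : ‖c'‖ₑ * (κ * B) ≤ A * ENNReal.ofReal M * ‖z‖ₑ :=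
      calc ‖c'‖ₑ * (κ * B) = κ * (B * ‖c'‖ₑ) := by ring
        _ ≤ κ * cochainNorm F p (F.untwisted c') := by
          gcongr
          exact hB' c'
        _ ≤ A * ‖F.opCLM hS π a z‖ₑ := (hc ▸ h2).trans (hA' _)
        _ ≤ A * ENNReal.ofReal M * ‖z‖ₑ := by
          rw [mul_assoc]
          gcongr
    have h5 : ‖c'‖ₑ ≤ A * ENNReal.ofReal M / (κ * B) * ‖z‖ₑ := by
      rw [← ENNReal.mul_div_right_comm, ENNReal.le_div_iff_mul_le (Or.inl (mul_ne_zero hκ0.ne' hB))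
        (Or.inr (ENNReal.mul_ne_top (ENNReal.mul_ne_top hA ENNReal.ofReal_ne_top) enorm_ne_top))]
      exact h4
    have h6 := ENNReal.toReal_mono (ENNReal.mul_ne_top hD enorm_ne_top) h5
    rw [ENNReal.toReal_mul, toReal_enorm, toReal_enorm] at h6
    exact h6.trans (mul_le_mul_of_nonneg_right (le_max_right _ _) (norm_nonneg _))
  obtain ⟨C, hC1, hC⟩ := hC
  have hC0 : 0 < C := zero_lt_one.trans_le hC1
  -- This δ makes 2(K + M + 1)d < C⁻¹ for d < δ, as the perturbation lemma demands; the summand 1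
  -- keeps the denominator positive if K = M = 0.
  have hden : 0 < 2 * (K + M + 1) * C := by positivity
  refine ⟨(2 * (K + M + 1) * C)⁻¹, inv_pos.2 hden, fun π ρ hπ hd => (hvan ρ).2 ?_⟩
  have hd0 : 0 ≤ dist (α := HomU H S) ρ π := dist_nonneg
  refine exists_apply_eq_of_perturbation (D := F.opCLM hS π OrdChain.bd)
    (D' := F.opCLM hS ρ OrdChain.bd) (e := F.opCLM hS π a) (e' := F.opCLM hS ρ a)
    (ε := (K + M + 1) * dist (α := HomU H S) ρ π) (hC π hπ) hC1 (fun z => ?_) (fun x => ?_) ?_ ?_ ?_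
  · simp only [opCLM_apply]
    rw [F.op_op _ heq, haa]
  · simp only [opCLM_apply]
    rw [F.op_op _ commutesWithTranslations_bd, hba]
  · exact (hK ρ π).2.trans (mul_le_mul_of_nonneg_right (by linarith) hd0)
  · exact (hM ρ π).2.trans (mul_le_mul_of_nonneg_right (by linarith) hd0)
  · rw [← mul_assoc, ← lt_div_iff₀' (by positivity)]
    refine hd.trans_le (le_of_eq ?_)
    field_simp

end FundamentalDomain

end Norms

end HigherKazhdan

end

theorem mainTheorem11
    {Γ : Type} [Group Γ] {V : Type} [DecidableEq V] [MulAction Γ V]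
    (X : AbstractSimplicialComplex V) [IsSimplicialAction X Γ]
    (n : ℕ) (hn : 1 ≤ n)
    (hX : IsTypeFModel X Γ n)
    (hcd : cohomologicalDimension Γ = n)
    (F : FundamentalDomain X Γ)
    (S : Finset Γ) (hS : Subgroup.closure (S : Set Γ) = ⊤)
    (p : ℝ) (hp : 1 ≤ p)
    {H : Type} [NormedAddCommGroup H] [InnerProductSpace ℂ H] [CompleteSpace H]
    (hκ : 0 < ⨅ (π : Γ →* unitary (H →L[ℂ] H)) (_ : CohomologyVanishes n π),
      kazhdanConstant F p (n - 1) π)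
    (C : Set (HomU H S)) (hC : ∃ π₀ : HomU H S, C = connectedComponent π₀) :
    (∃ π ∈ C, CohomologyVanishes n π) ↔ (∀ π ∈ C, CohomologyVanishes n π) := by
  obtain ⟨m, rfl⟩ : ∃ m, n = m + 1 := ⟨n - 1, by omega⟩
  have := hX.contractible
  -- An arbitrary well-order of the vertices, serving only to select sorted representatives.
  let _ : LinearOrder V := by
    classical
    exact linearOrderOfSTO WellOrderingRel
  obtain ⟨δ, hδ, h⟩ := F.exists_forall_cohomologyVanishes_of_dist_lt hX hcd.le hS hp hκ
  obtain ⟨π₀, rfl⟩ := hC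
  -- The same δ works around every point, so a representation without vanishing has none with
  -- vanishing within δ.
  have hclopen : IsClopen {π : HomU H S | CohomologyVanishes (m + 1) π} := by
    refine ⟨isOpen_compl_iff.1 (Metric.isOpen_iff.2 fun ρ hρ => ⟨δ, hδ, fun π hπ hπ' => hρ ?_⟩),
      Metric.isOpen_iff.2 fun π hπ => ⟨δ, hδ, fun ρ hρ => h π ρ hπ hρ⟩⟩
    exact h π ρ hπ' (Metric.mem_ball'.1 hπ)
  refine ⟨fun ⟨π, hπ, hπ'⟩ ρ hρ => ?_, fun hall => ⟨π₀, mem_connectedComponent, hall _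
    mem_connectedComponent⟩⟩
  rw [connectedComponent_eq hπ] at hρ
  exact hclopen.connectedComponent_subset hπ' hρ
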